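/- Let $q$ be a prime power, let $\ell, m, n_1,\dots,n_\ell$ be positive integers with $n_i\le m$ for all $i$, put $n=n_1+\dots+n_\ell$, $[k]=\{1,\dots,k\}$ (with $[0]=\emptyset$), and let $\mathbb M=\mathbb F_q^{m\times n_1}\times\dots\times\mathbb F_q^{m\times n_\ell}$. For $C=(C_1,\dots,C_\ell)\in\mathbb M$ let $\mathrm{srk}(C)=\sum_i \mathrm{rk}(C_i)$. A code is an $\mathbb F_q$-linear subspace $\mathcal C\subseteq\mathbb M$; let $\mathrm{maxsrk}(\mathcal C)=\max\{\mathrm{srk}(C): C\in\mathcal C\}$, and let its dual be $\mathcal C^\perp=\{D\in\mathbb M: \sum_i \mathrm{tr}(D_iC_i^t)=0 \text{ for all } C\in\mathcal C\}$. A linear subspace $\mathcal A_i\subseteq\mathbb F_q^{m\times n_i}$ is an optimal anticode if $\dim\mathcal A_i=\max\{m\,\mathrm{rk}(A): A\in\mathcal A_i\}$. For $r\in[\dim\mathcal C]$, the $r$-th generalized sum-rank weight of $\mathcal C$ is $$d_r(\mathcal C)=\min\{\mathrm{maxsrk}(\mathcal A): \mathcal A=\mathcal A_1\times\dots\times\mathcal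 A_\ell,\ \mathcal A_i\subseteq\mathbb F_q^{m\times n_i} \text{ optimal anticodes},\ \dim(\mathcal C\cap\mathcal A)\ge r\}.$$ For $r\in\mathbb Z$ put $$W_r(\mathcal C)=\{d_{r+sm}(\mathcal C): s\in\mathbb Z,\ r+sm\in[\dim\mathcal C]\},\qquad \overline W_r(\mathcal C)=\{n+1-d_{r+sm}(\mathcal C): s\in\mathbb Z,\ r+sm\in[\dim\mathcal C]\}.$$ Theorem. For every code $\mathcal C\subseteq\mathbb M$ and every $r\in[m]$, $$W_r(\mathcal C^\perp)=[n]\setminus\overline W_{r+\dim\mathcal C}(\mathcal C).$$ In particular, the generalized weights of $\mathcal C$ determine those of $\mathcal C^\perp$: if $\mathcal C,\mathcal D\subseteq\mathbb M$ are codes with $\dim\mathcal C=\dim\mathcal D$ and $d_r(\mathcal C)=d_r(\mathcal D)$ for all $r\in[\dim\mathcal C]$, then $\dim\mathcal C^\perp=\dim\mathcal D^\perp$ and $d_r(\mathcal C^\perp)=d_r(\mathcal D^\perp)$ for all $r\in[\dim\mathcal C^\perp]$. -/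

import Mathlib

namespace SumRank

/-- The ambient space `F^(m₁ × n₁) × ⋯ × F^(m_ℓ × n_ℓ)`. -/
abbrev Space (F : Type*) {ℓ : ℕ} (m n : Fin ℓ → ℕ) : Type _ :=
  (i : Fin ℓ) → Matrix (Fin (m i)) (Fin (n i)) F

/-- The sum-rank weight `srk(C) = ∑ᵢ rk(Cᵢ)`. -/
noncomputable def srk {F : Type*} [Field F] {ℓ : ℕ} {m n : Fin ℓ → ℕ}
    (C : Space F m n) : ℕ :=
  ∑ i, (C i).rank

/-- The maximum sum-rank weight of a code. The set of weights contains `0` and is bounded by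
`n₁ + ⋯ + n_ℓ`, so the supremum in `ℕ` is a maximum. -/
noncomputable def maxsrk {F : Type*} [Field F] {ℓ : ℕ} {m n : Fin ℓ → ℕ}
    (𝒞 : Submodule F (Space F m n)) : ℕ :=
  sSup {w | ∃ C ∈ 𝒞, w = srk C}

/-- An optimal anticode in the rank metric: a linear space `A` of `m × n` matrices with
`dim A = max {m * rk(M) : M ∈ A}`. (The set is nonempty and bounded by `m * n`.) -/
def IsOptimalAnticode {F : Type*} [Field F] {m n : ℕ}
    (A : Submodule F (Matrix (Fin m) (Fin n) F)) : Prop :=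
  Module.finrank F A = sSup {w | ∃ M ∈ A, w = m * M.rank}

/-- The `r`-th generalized sum-rank weight `d_r(𝒞)`, meaningful for `1 ≤ r ≤ dim 𝒞`: the minimum
of `maxsrk(A)` over the products `A = A₁ × ⋯ × A_ℓ` of optimal rank-metric anticodes with
`dim (𝒞 ∩ A) ≥ r`. -/
noncomputable def genWeight {F : Type*} [Field F] {ℓ : ℕ} {m n : Fin ℓ → ℕ}
    (𝒞 : Submodule F (Space F m n)) (r : ℕ) : ℕ :=
  sInf {w | ∃ A : (i : Fin ℓ) → Submodule F (Matrix (Fin (m i)) (Fin (n i)) F),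
    (∀ i, IsOptimalAnticode (A i)) ∧
    r ≤ Module.finrank F ↥(𝒞 ⊓ Submodule.pi Set.univ A) ∧
    w = maxsrk (Submodule.pi Set.univ A)}

/-- The bilinear form `Tr(D, C) = ∑ᵢ tr(Dᵢ Cᵢᵗ)`. -/
def traceForm {F : Type*} [Field F] {ℓ : ℕ} {m n : Fin ℓ → ℕ} (D C : Space F m n) : F :=
  ∑ i, (D i * (C i).transpose).trace

/-- The dual code `𝒞^⊥ = {D : Tr(D, C) = 0 for all C ∈ 𝒞}`. -/
def dual {F : Type*} [Field F] {ℓ : ℕ} {m n : Fin ℓ → ℕ}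
    (𝒞 : Submodule F (Space F m n)) : Submodule F (Space F m n) where
  carrier := {D | ∀ C ∈ 𝒞, traceForm D C = 0}
  zero_mem' := by
    intro C _
    simp [traceForm]
  add_mem' := by
    intro D D' hD hD' C hC
    have h1 := hD C hC
    have h2 := hD' C hC
    simp only [traceForm] at h1 h2 ⊢
    simp [Matrix.add_mul, Finset.sum_add_distrib, h1, h2]
  smul_mem' := by
    intro a D hD C hC
    have h1 := hD C hC
    simp only [traceForm] at h1 ⊢
    simp [← Finset.mul_sum, h1]

/-- For a code in `F^(m × n₁) × ⋯ × F^(m × n_ℓ)` and `r ∈ ℤ`, the set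
`W_r(𝒞) = {d_{r+sm}(𝒞) : s ∈ ℤ, r + sm ∈ [dim 𝒞]}`; here `t = r + sm`. -/
def weightSet {F : Type*} [Field F] {ℓ m : ℕ} {n : Fin ℓ → ℕ}
    (𝒞 : Submodule F (Space F (fun _ : Fin ℓ => m) n)) (r : ℤ) : Set ℤ :=
  {w | ∃ (s : ℤ) (t : ℕ), (t : ℤ) = r + s * m ∧ 1 ≤ t ∧ t ≤ Module.finrank F 𝒞 ∧
    w = (genWeight 𝒞 t : ℤ)}

/-- The set `{n + 1 - d_{r+sm}(𝒞) : s ∈ ℤ, r + sm ∈ [dim 𝒞]}` with `n = n₁ + ⋯ + n_ℓ`. -/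
def coweightSet {F : Type*} [Field F] {ℓ m : ℕ} {n : Fin ℓ → ℕ}
    (𝒞 : Submodule F (Space F (fun _ : Fin ℓ => m) n)) (r : ℤ) : Set ℤ :=
  {w | ∃ (s : ℤ) (t : ℕ), (t : ℤ) = r + s * m ∧ 1 ≤ t ∧ t ≤ Module.finrank F 𝒞 ∧
    w = ((∑ i, n i : ℕ) : ℤ) + 1 - (genWeight 𝒞 t : ℤ)}

end SumRank

/-! Everything is read off from the predicate `Meets 𝒞 j t`, which is downward closed in `t` and,
for `j ≤ n`, increasing in `j`; thus `d_r(𝒞)` is the least `j` with `Meets 𝒞 j r`. If `A` is a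
product of optimal anticodes of total rank `j`, then `A^⊥` is one of total rank `n - j`, and
counting dimensions gives `dim(𝒞^⊥ ∩ A^⊥) = dim(𝒞 ∩ A) + m(n - j) - dim 𝒞`. Hence `Meets` for `𝒞^⊥`
at `j` is `Meets` for `𝒞` at `n - j` with `t` shifted by `dim 𝒞 - mj` (`meets_dual_iff`). Modulo `m`
the shift is just `dim 𝒞`, which is why the weights are grouped in residue classes.

The number `w + 1` lies in `W_r(𝒞^⊥)` iff some term of the progression `r + mℤ` is met at `w + 1`
and not at `w`. Duality turns this into a condition on the step from `a` to `a + 1` for `𝒞`, where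
`a = n - w - 1`, and `exists_iff_not_exists_of_antitone` shows it to be the negation of `a + 1 ∈
W_{r + dim 𝒞}(𝒞)`.

Two facts about optimal anticodes carry the weight. Their orthogonals are optimal
(`rank_add_le_of_mem_traceOrthogonal`): an orthogonal map of too large rank would lie in a maximum
rank distance code, built from linearized polynomials, and a double complement argument kills it.
And each contains an optimal anticode of rank one less (`exists_le_rank_le_pred`), which makes
`Meets` lose at most `m` when `j` drops by one and, dually, makes it monotone in `j`. Instead of a
full classification, the second fact uses only that an optimal anticode of positive rank contains
all `y ⊗ φ` for one fixed `φ ≠ 0` or, in the square case, one fixed `y ≠ 0`. This is proved by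
induction on `dim V`, passing to quotients, hyperplanes and orthogonals until a rank one element is
available. Here `y ⊗ φ` denotes the map `φ.smulRight y`. -/

set_option linter.unusedSectionVars false

namespace SumRank

open Module LinearMap

/-! ### Linearized polynomials over a finite field. -/

section LinearizedPolynomials

variable {F : Type*} [Field F] [Fintype F] {L : Type*} [Field L] [Algebra F L]

/-- The `F`-linear map `x ↦ ∑ aᵢ x^(qⁱ)` attached to a coefficient vector. -/
noncomputable def linearizedMap (F : Type*) [Field F] [Fintype F] (L : Type*) [Field L]
    [Algebra F L] (r : ℕ) : (Fin r → L) →ₗ[F] (L →ₗ[F] L) :=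
  (Fintype.linearCombination L
    (fun i : Fin r => ((FiniteField.frobeniusAlgHom F L) ^ (i : ℕ)).toLinearMap)).restrictScalars F

theorem linearizedMap_apply {r : ℕ} (a : Fin r → L) (x : L) :
    linearizedMap F L r a x = ∑ i, a i * x ^ (Fintype.card F) ^ (i : ℕ) := by
  simp [linearizedMap, Fintype.linearCombination_apply, AlgHom.coe_pow,
    FiniteField.coe_frobeniusAlgHom, pow_iterate]

/-- The kernel is the root set of a nonzero polynomial of degree at most `q^(r-1)`, so it has at
most `q^(r-1)` elements. -/
theorem finrank_ker_linearizedMap_lt [Finite L] {r : ℕ} {a : Fin r → L} (ha : a ≠ 0) :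
    finrank F (ker (linearizedMap F L r a)) < r := by
  classical
  obtain ⟨i₀, hi₀⟩ := Function.ne_iff.mp ha
  have hr : 0 < r := i₀.pos
  have hq : 1 < Fintype.card F := Fintype.one_lt_card
  set P : Polynomial L :=
    ∑ i : Fin r, Polynomial.C (a i) * Polynomial.X ^ (Fintype.card F) ^ (i : ℕ) with hP
  have hcoeff : P.coeff ((Fintype.card F) ^ (i₀ : ℕ)) = a i₀ := by
    rw [hP, Polynomial.finsetSum_coeff, Finset.sum_eq_single i₀]
    · simp
    · intro i _ hi
      rw [Polynomial.coeff_C_mul_X_pow, if_neg]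
      intro h
      exact hi (Fin.ext (Nat.pow_right_injective hq h).symm)
    · simp
  have hP0 : P ≠ 0 := by
    intro h
    rw [h] at hcoeff
    exact hi₀ (by simpa using hcoeff.symm)
  have hdeg : P.natDegree ≤ (Fintype.card F) ^ (r - 1) := by
    refine Polynomial.natDegree_sum_le_of_forall_le _ _ fun i _ => ?_
    refine (Polynomial.natDegree_C_mul_X_pow_le _ _).trans ?_
    exact Nat.pow_le_pow_right (by omega) (by omega)
  have hroot : ∀ x ∈ ker (linearizedMap F L r a), x ∈ P.roots.toFinset := by
    intro x hx
    rw [LinearMap.mem_ker, linearizedMap_apply] at hx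
    rw [Multiset.mem_toFinset, Polynomial.mem_roots hP0, Polynomial.IsRoot.def, hP,
      Polynomial.eval_finsetSum]
    simpa using hx
  have hcard : Nat.card (ker (linearizedMap F L r a)) ≤ (Fintype.card F) ^ (r - 1) := by
    refine le_trans ?_ hdeg
    refine le_trans ?_ (Polynomial.card_roots' P)
    refine le_trans ?_ (Multiset.toFinset_card_le _)
    rw [← Nat.card_eq_finsetCard]
    exact Nat.card_le_card_of_injective (fun x => ⟨x.1, hroot x.1 x.2⟩)
      (fun x y h => Subtype.ext (by simpa using h))
  have : Module.Finite F L := Module.Finite.of_finite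
  rw [Module.natCard_eq_pow_finrank (K := F), Nat.card_eq_fintype_card,
    Nat.pow_le_pow_iff_right hq] at hcard
  omega

theorem exists_linearizedMap_of_le {r s : ℕ} (h : s ≤ r) (a : Fin s → L) :
    ∃ b : Fin r → L, linearizedMap F L r b = linearizedMap F L s a := by
  obtain ⟨d, rfl⟩ := Nat.exists_eq_add_of_le h
  refine ⟨Fin.append a 0, ?_⟩
  ext x
  simp [linearizedMap_apply, Fin.sum_univ_add]

end LinearizedPolynomials

/-! ### Maximum rank distance codes through a prescribed map. -/

section MaximumRankDistance

variable {F : Type*} [Field F] {V W : Type*} [AddCommGroup V] [Module F V]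
  [AddCommGroup W] [Module F W] [FiniteDimensional F V] [FiniteDimensional F W]

/-- Linear maps with the same kernel differ by an isomorphism of the codomains. -/
theorem exists_linearEquiv_comp_eq_of_ker_eq {L : Type*} [AddCommGroup L] [Module F L]
    (hd : finrank F L = finrank F W) {f : V →ₗ[F] L} {g : V →ₗ[F] W} (h : ker f = ker g)
    [FiniteDimensional F L] :
    ∃ e : L ≃ₗ[F] W, e.toLinearMap ∘ₗ f = g := by
  let e₀ : L ≃ₗ[F] W := LinearEquiv.ofFinrankEq _ _ hd
  have h' : ker (e₀.toLinearMap ∘ₗ f) = ker g := by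
    rw [LinearEquiv.ker_comp, h]
  let e₁ : range (e₀.toLinearMap ∘ₗ f) ≃ₗ[F] range g :=
    (quotKerEquivRange _).symm ≪≫ₗ Submodule.quotEquivOfEq _ _ h' ≪≫ₗ quotKerEquivRange g
  -- Both ranges are the quotient by the common kernel; the resulting isomorphism of subspaces of
  -- `W` extends to an automorphism of `W`.
  obtain ⟨e₂, he₂⟩ := Submodule.exists_linearEquiv_restrict_eq e₁
  refine ⟨e₀ ≪≫ₗ e₂, ?_⟩
  ext x
  have h1 := he₂ ⟨(e₀.toLinearMap ∘ₗ f) x, LinearMap.mem_range_self _ x⟩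
  have h2 : e₁ ⟨(e₀.toLinearMap ∘ₗ f) x, LinearMap.mem_range_self _ x⟩
      = ⟨g x, LinearMap.mem_range_self _ x⟩ := by
    simp only [e₁, LinearEquiv.trans_apply]
    have : (e₀.toLinearMap ∘ₗ f).quotKerEquivRange.symm
        ⟨(e₀.toLinearMap ∘ₗ f) x, LinearMap.mem_range_self _ x⟩ = Submodule.Quotient.mk x := by
      rw [LinearEquiv.symm_apply_eq]
      rfl
    rw [this]
    rfl
  rw [h2] at h1
  simpa using h1.symm

/-- Over a finite field, every map whose kernel is small lies in a maximum rank distance code. -/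
theorem exists_maximumRankDistance_mem [Finite F] (hVW : finrank F V ≤ finrank F W) {r : ℕ}
    (hr : r ≤ finrank F V) (D : V →ₗ[F] W) (hD : finrank F (ker D) < r) :
    ∃ C : Submodule F (V →ₗ[F] W), D ∈ C ∧ finrank F C = finrank F W * r ∧
      ∀ N ∈ C, N ≠ 0 → finrank F (ker N) < r := by
  classical
  have : Fintype F := Fintype.ofFinite F
  obtain ⟨p, hp⟩ := CharP.exists F
  have : Fact p.Prime := ⟨CharP.char_is_prime F p⟩
  have : NeZero (finrank F W) := ⟨by omega⟩
  let L := FiniteField.Extension F p (finrank F W)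
  have hL : finrank F L = finrank F W := FiniteField.finrank_extension F p (finrank F W)
  have : Finite L := inferInstance
  have : FiniteDimensional F L := inferInstance
  obtain ⟨φ, hφ⟩ : ∃ φ : V →ₗ[F] L, Function.Injective φ := by
    rw [← hL] at hVW
    exact finrank_le_iff_exists_linearMap.mp hVW
  have hker : ∀ {s : ℕ} (a : Fin s → L), a ≠ 0 →
      finrank F (ker (linearizedMap F L s a ∘ₗ φ)) < s := by
    intro s a ha
    refine lt_of_le_of_lt ?_ (finrank_ker_linearizedMap_lt (F := F) ha)
    rw [LinearMap.ker_comp, (Submodule.equivMapOfInjective φ hφ _).finrank_eq]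
    exact Submodule.finrank_mono (Submodule.map_comap_le _ _)
  -- a linearized polynomial whose kernel on `V` is exactly the kernel of `D`
  obtain ⟨a, ha0, ha⟩ : ∃ a : Fin (finrank F (ker D) + 1) → L, a ≠ 0 ∧
      ker D ≤ ker (linearizedMap F L _ a ∘ₗ φ) := by
    let T : (Fin (finrank F (ker D) + 1) → L) →ₗ[F] (ker D →ₗ[F] L) :=
      (LinearMap.lcomp F L (φ ∘ₗ (ker D).subtype)) ∘ₗ linearizedMap F L _
    -- With `d = dim ker D`, there are `(d + 1) * dim W` parameters over `F` against `d * dim W`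
    -- linear conditions.
    have hT : ker T ≠ ⊥ := by
      apply LinearMap.ker_ne_bot_of_finrank_lt
      rw [Module.finrank_linearMap, Module.finrank_pi_fintype]
      simp only [Finset.sum_const, Finset.card_univ, Fintype.card_fin, smul_eq_mul, hL]
      have : 0 < finrank F W := by omega
      nlinarith
    obtain ⟨a, haT, ha0⟩ := (Submodule.ne_bot_iff _).mp hT
    refine ⟨a, ha0, fun x hx => ?_⟩
    have := congrArg (fun f => f ⟨x, hx⟩) (LinearMap.mem_ker.mp haT)
    simpa [T] using this
  -- A nonzero linearized polynomial with `dim ker D + 1` coefficients cannot vanish on more than a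
  -- space of dimension `dim ker D`.
  have hkerEq : ker (linearizedMap F L _ a ∘ₗ φ) = ker D :=
    (Submodule.eq_of_le_of_finrank_le ha (by have := hker a ha0; omega)).symm
  obtain ⟨e, he⟩ := exists_linearEquiv_comp_eq_of_ker_eq hL hkerEq
  let T : (Fin r → L) →ₗ[F] (V →ₗ[F] W) :=
    (LinearMap.llcomp F V L W e.toLinearMap) ∘ₗ (LinearMap.lcomp F L φ) ∘ₗ linearizedMap F L r
  have hTapp : ∀ b, T b = e.toLinearMap ∘ₗ (linearizedMap F L r b ∘ₗ φ) := fun b => rfl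
  have hTker : ∀ b, b ≠ 0 → finrank F (ker (T b)) < r := by
    intro b hb
    rw [hTapp, LinearEquiv.ker_comp]
    exact hker b hb
  refine ⟨range T, ?_, ?_, ?_⟩
  · obtain ⟨b, hb⟩ := exists_linearizedMap_of_le (F := F) (show finrank F (ker D) + 1 ≤ r from hD) a
    exact ⟨b, by rw [hTapp, hb, he]⟩
  · rw [LinearMap.finrank_range_of_inj, Module.finrank_pi_fintype]
    · simp [hL, mul_comm]
    · rw [← LinearMap.ker_eq_bot, Submodule.eq_bot_iff]
      intro b hb
      by_contra hb0
      have := hTker b hb0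
      rw [LinearMap.mem_ker.mp hb, LinearMap.ker_zero, finrank_top] at this
      omega
  · rintro N ⟨b, rfl⟩ hN
    exact hTker b (by rintro rfl; simp at hN)

end MaximumRankDistance

end SumRank

namespace SumRank

open Module LinearMap

/-! ### Orthogonality for the trace pairing. -/

section TracePairing

variable {F : Type*} [Field F] {V W : Type*} [AddCommGroup V] [Module F V]
  [AddCommGroup W] [Module F W]

/-- The pairing `(D, N) ↦ tr (D ∘ N)`. -/
noncomputable def tracePairing (F V W : Type*) [Field F] [AddCommGroup V] [Module F V]
    [AddCommGroup W] [Module F W] : (V →ₗ[F] W) →ₗ[F] Dual F (W →ₗ[F] V) :=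
  (LinearMap.llcomp F W V W).compr₂ (LinearMap.trace F W)

theorem tracePairing_apply (D : V →ₗ[F] W) (N : W →ₗ[F] V) :
    tracePairing F V W D N = LinearMap.trace F W (D ∘ₗ N) := rfl

/-- The orthogonal space with respect to the trace pairing. -/
noncomputable def traceOrthogonal (A : Submodule F (W →ₗ[F] V)) : Submodule F (V →ₗ[F] W) :=
  A.dualAnnihilator.comap (tracePairing F V W)

theorem mem_traceOrthogonal {A : Submodule F (W →ₗ[F] V)} {D : V →ₗ[F] W} :
    D ∈ traceOrthogonal A ↔ ∀ N ∈ A, LinearMap.trace F W (D ∘ₗ N) = 0 := by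
  simp [traceOrthogonal, Submodule.mem_dualAnnihilator, tracePairing_apply]

variable [FiniteDimensional F V] [FiniteDimensional F W]

/-- Pairing `D` with the rank one map `x ⊗ φ` returns `φ (D x)`, which detects `D`. -/
theorem tracePairing_injective : Function.Injective (tracePairing F V W) := by
  rw [← LinearMap.ker_eq_bot, Submodule.eq_bot_iff]
  intro D hD
  ext x
  rw [LinearMap.zero_apply, ← Module.forall_dual_apply_eq_zero_iff F]
  intro φ
  have h : tracePairing F V W D (φ.smulRight x) = 0 := by
    rw [LinearMap.mem_ker.mp hD, LinearMap.zero_apply]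
  have h2 : D ∘ₗ φ.smulRight x = φ.smulRight (D x) := by
    ext z
    simp
  rw [tracePairing_apply, h2, LinearMap.trace_smulRight] at h
  exact h

theorem finrank_add_finrank_traceOrthogonal (A : Submodule F (W →ₗ[F] V)) :
    finrank F A + finrank F (traceOrthogonal A) = finrank F V * finrank F W := by
  have hd : finrank F (V →ₗ[F] W) = finrank F (Dual F (W →ₗ[F] V)) := by
    rw [Subspace.dual_finrank_eq, Module.finrank_linearMap, Module.finrank_linearMap, mul_comm]
  let e := LinearEquiv.ofInjectiveOfFinrankEq (tracePairing F V W) tracePairing_injective hd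
  have h1 : finrank F (traceOrthogonal A) = finrank F A.dualAnnihilator := by
    have : traceOrthogonal A = A.dualAnnihilator.map e.symm.toLinearMap := by
      rw [Submodule.map_equiv_eq_comap_symm]
      rfl
    rw [this, LinearEquiv.finrank_map_eq]
  rw [h1, Subspace.finrank_add_finrank_dualAnnihilator_eq, Module.finrank_linearMap, mul_comm]

theorem eq_zero_of_trace_comp_eq_zero {D : V →ₗ[F] W}
    (h : ∀ N : W →ₗ[F] V, LinearMap.trace F W (D ∘ₗ N) = 0) : D = 0 := by
  apply tracePairing_injective (F := F)
  ext N
  simp [tracePairing_apply, h]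

/-- The maps vanishing on a subspace `U`. -/
noncomputable def vanishingOn (U : Submodule F V) : Submodule F (V →ₗ[F] W) :=
  ker (LinearMap.lcomp F W U.subtype)

theorem mem_vanishingOn {U : Submodule F V} {N : V →ₗ[F] W} :
    N ∈ vanishingOn U ↔ ∀ x ∈ U, N x = 0 := by
  simp [vanishingOn, LinearMap.ext_iff]

theorem finrank_vanishingOn (U : Submodule F V) :
    finrank F (vanishingOn U : Submodule F (V →ₗ[F] W)) + finrank F U * finrank F W =
      finrank F V * finrank F W := by
  have h := LinearMap.finrank_range_add_finrank_ker (LinearMap.lcomp F W U.subtype)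
  have h1 : range (LinearMap.lcomp F W U.subtype) = ⊤ := by
    rw [LinearMap.range_eq_top]
    intro f
    obtain ⟨g, hg⟩ := LinearMap.exists_extend f
    exact ⟨g, hg⟩
  rw [h1, finrank_top, Module.finrank_linearMap, Module.finrank_linearMap] at h
  rw [vanishingOn]
  omega

end TracePairing

/-! ### Dimension bound for spaces of bounded rank, and duality of the extremal ones. -/

section RankBounds

theorem exists_le_finrank_eq {F : Type*} [Field F] {V : Type*} [AddCommGroup V] [Module F V]
    [FiniteDimensional F V] {S : Submodule F V} {d : ℕ} (hS : finrank F S ≤ d)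
    (hd : d ≤ finrank F V) : ∃ U : Submodule F V, S ≤ U ∧ finrank F U = d := by
  induction d, hS using Nat.le_induction with
  | base => exact ⟨S, le_rfl, rfl⟩
  | succ d _ ih =>
    obtain ⟨U, hSU, hU⟩ := ih (by omega)
    have hne : U ≠ ⊤ := by
      rintro rfl
      rw [finrank_top] at hU
      omega
    obtain ⟨x, -, hx⟩ := SetLike.exists_of_lt hne.lt_top
    refine ⟨U ⊔ F ∙ x, hSU.trans le_sup_left, ?_⟩
    have h := Submodule.finrank_sup_add_finrank_inf_eq U (F ∙ x)
    rw [(Submodule.disjoint_span_singleton_of_notMem hx).eq_bot, finrank_bot,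
      finrank_span_singleton (by rintro rfl; exact hx U.zero_mem)] at h
    omega

variable {F : Type*} [Field F] [Finite F] {V W : Type*} [AddCommGroup V] [Module F V]
  [AddCommGroup W] [Module F W] [FiniteDimensional F V] [FiniteDimensional F W]

/-- For `k < dim V`, a maximum rank distance code whose nonzero elements have rank above `k` meets
`A` in zero, and its dimension `dim W * (dim V - k)` leaves room only for the stated bound. -/
theorem finrank_le_of_rank_le_of_le (hVW : finrank F V ≤ finrank F W) {k : ℕ}
    {A : Submodule F (V →ₗ[F] W)} (hA : ∀ N ∈ A, finrank F (range N) ≤ k) :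
    finrank F A ≤ finrank F W * k := by
  rcases le_or_gt (finrank F V) k with hk | hk
  · refine (Submodule.finrank_le A).trans ?_
    rw [Module.finrank_linearMap, mul_comm]
    exact Nat.mul_le_mul_left _ hk
  · obtain ⟨D, hD⟩ := finrank_le_iff_exists_linearMap.mp hVW
    obtain ⟨C, -, hC, hCk⟩ := exists_maximumRankDistance_mem hVW
      (r := finrank F V - k) (by omega) D (by
        rw [LinearMap.ker_eq_bot.mpr hD, finrank_bot]; omega)
    have hdisj : A ⊓ C = ⊥ := by
      rw [Submodule.eq_bot_iff]
      rintro N ⟨hNA, hNC⟩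
      by_contra hN
      have h1 := hCk N hNC hN
      have h2 := hA N hNA
      have h3 := LinearMap.finrank_range_add_finrank_ker N
      omega
    have h1 := Submodule.finrank_sup_add_finrank_inf_eq A C
    have h2 := Submodule.finrank_le (A ⊔ C)
    rw [hdisj, finrank_bot, hC] at h1
    rw [Module.finrank_linearMap] at h2
    have h3 : finrank F W * (finrank F V - k) + finrank F W * k = finrank F V * finrank F W := by
      rw [← mul_add, Nat.sub_add_cancel hk.le, mul_comm]
    omega

theorem transpose_injective :
    Function.Injective (Dual.transpose (R := F) (M := V) (M' := W)) := by
  intro N N' h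
  ext x
  rw [← sub_eq_zero, ← Module.forall_dual_apply_eq_zero_iff F]
  intro φ
  have h' : φ (N x) = φ (N' x) := congrArg (fun f => f φ x) h
  rw [map_sub, h', sub_self]

/-- The space of transposed maps. -/
noncomputable def transposeSpace (A : Submodule F (V →ₗ[F] W)) :
    Submodule F (Dual F W →ₗ[F] Dual F V) :=
  A.map (Dual.transpose (R := F) (M := V) (M' := W))

theorem finrank_transposeSpace (A : Submodule F (V →ₗ[F] W)) :
    finrank F (transposeSpace A) = finrank F A :=
  (Submodule.equivMapOfInjective _ transpose_injective A).finrank_eq.symm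

theorem rank_le_of_mem_transposeSpace {k : ℕ} {A : Submodule F (V →ₗ[F] W)}
    (hA : ∀ N ∈ A, finrank F (range N) ≤ k) :
    ∀ N ∈ transposeSpace A, finrank F (range N) ≤ k := by
  rintro _ ⟨N, hN, rfl⟩
  exact (LinearMap.finrank_range_dualMap_eq_finrank_range N).trans_le (hA N hN)

/-- The dimension bound for spaces of maps of bounded rank. -/
theorem finrank_le_of_rank_le {k : ℕ} {A : Submodule F (V →ₗ[F] W)}
    (hA : ∀ N ∈ A, finrank F (range N) ≤ k) :
    finrank F A ≤ max (finrank F V) (finrank F W) * k := by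
  rcases le_total (finrank F V) (finrank F W) with h | h
  · rw [max_eq_right h]
    exact finrank_le_of_rank_le_of_le h hA
  · rw [max_eq_left h, ← finrank_transposeSpace, ← Subspace.dual_finrank_eq (K := F) (V := V)]
    refine finrank_le_of_rank_le_of_le ?_ (rank_le_of_mem_transposeSpace hA)
    rwa [Subspace.dual_finrank_eq, Subspace.dual_finrank_eq]

/-- Orthogonals of optimal anticodes consist of maps of small rank. -/
theorem rank_add_le_of_mem_traceOrthogonal (hVW : finrank F V ≤ finrank F W) {k : ℕ}
    (hk : k ≤ finrank F V) {A : Submodule F (W →ₗ[F] V)}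
    (hA : ∀ N ∈ A, finrank F (range N) ≤ k) (hdim : finrank F A = finrank F W * k)
    {D : V →ₗ[F] W} (hD : D ∈ traceOrthogonal A) :
    finrank F (range D) + k ≤ finrank F V := by
  by_contra hlt
  have hrn := LinearMap.finrank_range_add_finrank_ker D
  have hker : finrank F (ker D) < k := by omega
  -- The aim is that the orthogonal of `C` and `A` span everything. Since `D` is orthogonal to both,
  -- it must then vanish.
  obtain ⟨C, hDC, hC, hCk⟩ := exists_maximumRankDistance_mem hVW hk D hker
  have hdisj : traceOrthogonal C ⊓ A = ⊥ := by
    rw [Submodule.eq_bot_iff]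
    rintro E ⟨hEC, hEA⟩
    obtain ⟨U, hU, hUk⟩ : ∃ U : Submodule F V, range E ≤ U ∧ finrank F U = k :=
      exists_le_finrank_eq (hA E hEA) hk
    -- Nonzero elements of `C` have kernels of dimension below `k = dim U`. So `C` and the maps
    -- vanishing on `U` are complementary, and `E` pairs to zero with both.
    have hCU : C ⊓ vanishingOn U = ⊥ := by
      rw [Submodule.eq_bot_iff]
      rintro N ⟨hNC, hNU⟩
      by_contra hN
      have h1 := hCk N hNC hN
      have h2 : U ≤ ker N := fun x hx => mem_vanishingOn.mp hNU x hx
      have h3 := Submodule.finrank_mono h2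
      omega
    have htop : C ⊔ vanishingOn U = ⊤ := by
      apply Submodule.eq_top_of_finrank_eq
      have h1 := Submodule.finrank_sup_add_finrank_inf_eq C (vanishingOn U)
      rw [hCU, finrank_bot, hC] at h1
      have h2 := finrank_vanishingOn (W := W) U
      rw [hUk, mul_comm k] at h2
      rw [Module.finrank_linearMap]
      omega
    apply eq_zero_of_trace_comp_eq_zero
    intro N
    have hN : N ∈ C ⊔ vanishingOn U := by rw [htop]; trivial
    obtain ⟨N₁, hN₁, N₂, hN₂, rfl⟩ := Submodule.mem_sup.mp hN
    rw [LinearMap.comp_add, map_add, mem_traceOrthogonal.mp hEC N₁ hN₁, zero_add,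
      LinearMap.trace_comp_comm']
    have : N₂ ∘ₗ E = 0 := by
      ext x
      exact mem_vanishingOn.mp hN₂ _ (hU (LinearMap.mem_range_self _ _))
    rw [this, map_zero]
  have htop : traceOrthogonal C ⊔ A = ⊤ := by
    apply Submodule.eq_top_of_finrank_eq
    have h1 := Submodule.finrank_sup_add_finrank_inf_eq (traceOrthogonal C) A
    have h2 := finrank_add_finrank_traceOrthogonal C
    rw [hdisj, finrank_bot, hdim] at h1
    rw [Module.finrank_linearMap]
    omega
  have hD0 : D = 0 := by
    apply eq_zero_of_trace_comp_eq_zero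
    intro N
    have hN : N ∈ traceOrthogonal C ⊔ A := by rw [htop]; trivial
    obtain ⟨N₁, hN₁, N₂, hN₂, rfl⟩ := Submodule.mem_sup.mp hN
    rw [LinearMap.comp_add, map_add, mem_traceOrthogonal.mp hD N₂ hN₂, add_zero,
      LinearMap.trace_comp_comm']
    exact mem_traceOrthogonal.mp hN₁ D hDC
  rw [hD0, LinearMap.ker_zero, finrank_top] at hker
  omega

end RankBounds

end SumRank

namespace SumRank

open Module LinearMap

/-! ### Rank one maps in a space of bounded rank. -/

section RankOne

variable {F : Type*} [Field F] {V W : Type*} [AddCommGroup V] [Module F V]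
  [AddCommGroup W] [Module F W] [FiniteDimensional F V] [FiniteDimensional F W]

theorem finrank_map_add_finrank_inf_ker (f : V →ₗ[F] W) (S : Submodule F V) :
    finrank F (S.map f) + finrank F ↥(S ⊓ ker f) = finrank F S := by
  have h := LinearMap.finrank_range_add_finrank_ker (f.domRestrict S)
  rw [LinearMap.range_domRestrict, LinearMap.ker_domRestrict] at h
  rw [← h, ← Submodule.map_comap_subtype, Submodule.finrank_map_subtype_eq]

theorem finrank_quotient_span_singleton {y : W} (hy : y ≠ 0) :
    finrank F (W ⧸ (F ∙ y)) + 1 = finrank F W := by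
  have h := Submodule.finrank_quotient_add_finrank (F ∙ y)
  rwa [finrank_span_singleton hy] at h

theorem finrank_ker_add_one {φ : Dual F V} (hφ : φ ≠ 0) :
    finrank F (ker φ) + 1 = finrank F V :=
  Module.Dual.finrank_ker_add_one_of_ne_zero hφ

theorem exists_dual_apply_eq_one {φ : Dual F V} (hφ : φ ≠ 0) : ∃ v, φ v = 1 :=
  LinearMap.surjective_of_ne_zero hφ 1

theorem mkQ_span_singleton_eq_zero {y w : W} : (F ∙ y).mkQ w = 0 ↔ ∃ c : F, c • y = w := by
  rw [Submodule.mkQ_apply, Submodule.Quotient.mk_eq_zero, Submodule.mem_span_singleton]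

theorem eq_smulRight_of_vanish_on_ker {φ : Dual F V} {v : V} (hv : φ v = 1) {N : V →ₗ[F] W}
    (hN : ∀ x, φ x = 0 → N x = 0) : N = φ.smulRight (N v) := by
  ext x
  have h := hN (x - φ x • v) (by simp [hv])
  rw [map_sub, map_smul, sub_eq_zero] at h
  simpa using h

theorem exists_eq_smulRight_of_mkQ_eq_zero {y : W} (hy : y ≠ 0) {N : V →ₗ[F] W}
    (hN : ∀ x, (F ∙ y).mkQ (N x) = 0) : ∃ θ : Dual F V, N = θ.smulRight y := by
  have hmem : ∀ x, N x ∈ F ∙ y := fun x => by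
    have := hN x
    rwa [Submodule.mkQ_apply, Submodule.Quotient.mk_eq_zero] at this
  let e := LinearEquiv.toSpanNonzeroSingleton F W y hy
  refine ⟨e.symm.toLinearMap ∘ₗ N.codRestrict (F ∙ y) hmem, ?_⟩
  ext x
  have h : e (e.symm (N.codRestrict (F ∙ y) hmem x)) = N.codRestrict (F ∙ y) hmem x :=
    e.apply_symm_apply _
  have h2 := congrArg Subtype.val h
  rw [LinearEquiv.toSpanNonzeroSingleton_apply] at h2
  exact h2.symm

/-- The columns `y` with `y ⊗ φ ∈ A`. -/
noncomputable def columnSpace (A : Submodule F (V →ₗ[F] W)) (φ : Dual F V) : Submodule F W :=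
  A.comap (LinearMap.smulRightₗ φ)

/-- The rows `φ` with `y ⊗ φ ∈ A`. -/
noncomputable def rowSpace (A : Submodule F (V →ₗ[F] W)) (y : W) : Submodule F (Dual F V) :=
  A.comap (LinearMap.smulRightₗ.flip y)

theorem mem_columnSpace {A : Submodule F (V →ₗ[F] W)} {φ : Dual F V} {y : W} :
    y ∈ columnSpace A φ ↔ φ.smulRight y ∈ A := Iff.rfl

theorem mem_rowSpace {A : Submodule F (V →ₗ[F] W)} {φ : Dual F V} {y : W} :
    φ ∈ rowSpace A y ↔ φ.smulRight y ∈ A := Iff.rfl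

theorem finrank_inf_ker_restrict_le (A : Submodule F (V →ₗ[F] W)) {φ : Dual F V} (hφ : φ ≠ 0) :
    finrank F ↥(A ⊓ ker (LinearMap.lcomp F W (ker φ).subtype)) ≤ finrank F (columnSpace A φ) := by
  obtain ⟨v, hv⟩ := exists_dual_apply_eq_one hφ
  refine le_trans (Submodule.finrank_mono ?_)
    (Submodule.finrank_map_le (LinearMap.smulRightₗ φ) (columnSpace A φ))
  rintro N ⟨hNA, hN⟩
  have h := eq_smulRight_of_vanish_on_ker hv (N := N) (fun x hx => by
    simpa using congrArg (fun f => f ⟨x, hx⟩) (LinearMap.mem_ker.mp hN))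
  refine ⟨N v, ?_, h.symm⟩
  change φ.smulRight (N v) ∈ A
  rwa [← h]

theorem finrank_inf_ker_mkQ_le (A : Submodule F (V →ₗ[F] W)) {y : W} (hy : y ≠ 0) :
    finrank F ↥(A ⊓ ker (LinearMap.llcomp F V W (W ⧸ (F ∙ y)) (F ∙ y).mkQ)) ≤
      finrank F (rowSpace A y) := by
  refine le_trans (Submodule.finrank_mono ?_)
    (Submodule.finrank_map_le (LinearMap.smulRightₗ.flip y) (rowSpace A y))
  rintro N ⟨hNA, hN⟩
  obtain ⟨θ, hθ⟩ := exists_eq_smulRight_of_mkQ_eq_zero hy (N := N) (fun x => by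
    simpa using congrArg (fun f => f x) (LinearMap.mem_ker.mp hN))
  refine ⟨θ, ?_, hθ.symm⟩
  change θ.smulRight y ∈ A
  rwa [← hθ]

variable {k : ℕ} {A : Submodule F (V →ₗ[F] W)}

/-- Let `S = N(ker φ)`. If `y ∈ S`, the quotient by `y` loses a dimension. Otherwise one of `N` and
`N + y ⊗ φ` sends `v` outside `S`, so its range, of dimension at most `k`, strictly contains `S`. -/
theorem rank_compress_add_one_le (hA : ∀ N ∈ A, finrank F (range N) ≤ k) {y : W} (hy : y ≠ 0)
    {φ : Dual F V} (hφ : φ ≠ 0) (hyφ : φ.smulRight y ∈ A) {N : V →ₗ[F] W} (hN : N ∈ A) :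
    finrank F (range ((F ∙ y).mkQ ∘ₗ N ∘ₗ (ker φ).subtype)) + 1 ≤ k := by
  obtain ⟨v, hv⟩ := exists_dual_apply_eq_one hφ
  set S := range (N ∘ₗ (ker φ).subtype) with hS
  have hSmem : ∀ x, φ x = 0 → N x ∈ S := fun x hx => ⟨⟨x, hx⟩, rfl⟩
  rw [LinearMap.range_comp, ← hS]
  by_cases hyS : y ∈ S
  · have h := finrank_map_add_finrank_inf_ker (F ∙ y).mkQ S
    rw [Submodule.ker_mkQ, inf_eq_right.mpr ((Submodule.span_singleton_le_iff_mem _ _).mpr hyS),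
      finrank_span_singleton hy] at h
    rw [h]
    refine (Submodule.finrank_mono ?_).trans (hA N hN)
    rintro _ ⟨x, rfl⟩
    exact ⟨x, rfl⟩
  · obtain ⟨M, hMA, hMS, hMv⟩ : ∃ M ∈ A, S ≤ range M ∧ M v ∉ S := by
      by_cases h0 : N v ∈ S
      · refine ⟨N + φ.smulRight y, A.add_mem hN hyφ, ?_, ?_⟩
        · rintro _ ⟨x, rfl⟩
          refine ⟨x, ?_⟩
          have : φ x = 0 := x.2
          simp [this]
        · intro h
          apply hyS
          have := S.sub_mem h h0
          simpa [hv] using this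
      · refine ⟨N, hN, ?_, h0⟩
        rintro _ ⟨x, rfl⟩
        exact ⟨x, rfl⟩
    have h := Submodule.finrank_sup_add_finrank_inf_eq S (F ∙ M v)
    rw [(Submodule.disjoint_span_singleton_of_notMem hMv).eq_bot, finrank_bot,
      finrank_span_singleton (by intro h; rw [h] at hMv; exact hMv S.zero_mem)] at h
    have h2 : S ⊔ F ∙ M v ≤ range M :=
      sup_le hMS ((Submodule.span_singleton_le_iff_mem _ _).mpr ⟨v, rfl⟩)
    have h3 := Submodule.finrank_mono h2
    have h4 := hA M hMA
    have h5 := Submodule.finrank_map_le (F ∙ y).mkQ S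
    omega

/-- If the rank is still `k` modulo `y`, nothing was lost, so the quotient map is injective on the
range of `N`. -/
theorem apply_eq_zero_of_mkQ_apply_eq_zero (hA : ∀ N ∈ A, finrank F (range N) ≤ k) {y : W}
    {N : V →ₗ[F] W} (hN : N ∈ A) (hk : k ≤ finrank F (range ((F ∙ y).mkQ ∘ₗ N))) {z : V}
    (hz : (F ∙ y).mkQ (N z) = 0) : N z = 0 := by
  have h := finrank_map_add_finrank_inf_ker (F ∙ y).mkQ (range N)
  rw [← LinearMap.range_comp] at h
  have h1 := hA N hN
  have h2 : range N ⊓ ker (F ∙ y).mkQ = ⊥ := Submodule.finrank_eq_zero.mp (by omega)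
  exact (Submodule.mem_bot F).mp (h2 ▸ ⟨⟨z, rfl⟩, hz⟩)

end RankOne

/-! ### Large column or row spaces are full. -/

section Extremal

variable {F : Type*} [Field F] [Finite F] {V W : Type*} [AddCommGroup V] [Module F V]
  [AddCommGroup W] [Module F W] [FiniteDimensional F V] [FiniteDimensional F W]
  {k : ℕ} {A : Submodule F (V →ₗ[F] W)}

/-- Restrict to `ker φ`. If a restriction still had rank `k`, with range `S`, adding any `y ⊗ φ ∈ A`
could not enlarge the range, forcing the column space into the `k`-dimensional `S`. So all
restrictions have rank at most `k - 1`, and the dimension bound leaves at least `dim W` dimensions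
for the elements of `A` vanishing on `ker φ`. -/
theorem columnSpace_eq_top_of_lt (hVW : finrank F V ≤ finrank F W)
    (hA : ∀ N ∈ A, finrank F (range N) ≤ k) (hdim : finrank F A = finrank F W * k)
    (hk : 1 ≤ k) {φ : Dual F V} (hφ : φ ≠ 0) (hlt : k < finrank F (columnSpace A φ)) :
    columnSpace A φ = ⊤ := by
  obtain ⟨v, hv⟩ := exists_dual_apply_eq_one hφ
  have hrk : ∀ M ∈ A.map (LinearMap.lcomp F W (ker φ).subtype), finrank F (range M) ≤ k - 1 := by
    rintro _ ⟨N, hN, rfl⟩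
    by_contra hcon
    set S := range (LinearMap.lcomp F W (ker φ).subtype N) with hS
    have key : ∀ M ∈ A, S ≤ range M → range M = S := fun M hM hSM =>
      (Submodule.eq_of_le_of_finrank_le hSM (by have := hA M hM; omega)).symm
    have hSN : range N = S := key N hN (by rintro _ ⟨x, rfl⟩; exact ⟨x, rfl⟩)
    have hle : columnSpace A φ ≤ S := by
      intro y hy
      have h1 : range (N + φ.smulRight y) = S := by
        refine key _ (A.add_mem hN (mem_columnSpace.mp hy)) ?_
        rintro _ ⟨x, rfl⟩
        refine ⟨x, ?_⟩
        have : φ x = 0 := x.2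
        simp [this]
      have h2 : (N + φ.smulRight y) v ∈ S := h1 ▸ LinearMap.mem_range_self _ v
      have h3 : N v ∈ S := hSN ▸ LinearMap.mem_range_self _ v
      simpa [hv] using S.sub_mem h2 h3
    have h4 := Submodule.finrank_mono hle
    have h5 := hA N hN
    rw [hSN] at h5
    omega
  have hb := finrank_le_of_rank_le hrk
  have hker := finrank_ker_add_one hφ
  rw [max_eq_right (by omega)] at hb
  have hsum := finrank_map_add_finrank_inf_ker (LinearMap.lcomp F W (ker φ).subtype) A
  have hs := finrank_inf_ker_restrict_le A hφ
  apply Submodule.eq_top_of_finrank_eq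
  refine le_antisymm (Submodule.finrank_le _) ?_
  obtain ⟨j, rfl⟩ := Nat.exists_eq_add_of_le' hk
  rw [Nat.add_sub_cancel] at hb
  rw [mul_add, mul_one] at hdim
  omega

/-- The transposed argument: compose with the quotient by `y`. If some `N` keeps rank `k` there,
every row `ψ` with `y ⊗ ψ ∈ A` vanishes on the kernel of the composite, which has codimension `k`.
-/
theorem rowSpace_eq_top_of_lt (hVW : finrank F W ≤ finrank F V)
    (hA : ∀ N ∈ A, finrank F (range N) ≤ k) (hdim : finrank F A = finrank F V * k)
    (hk : 1 ≤ k) {y : W} (hy : y ≠ 0) (hlt : k < finrank F (rowSpace A y)) :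
    rowSpace A y = ⊤ := by
  have hrk : ∀ M ∈ A.map (LinearMap.llcomp F V W (W ⧸ (F ∙ y)) (F ∙ y).mkQ),
      finrank F (range M) ≤ k - 1 := by
    rintro _ ⟨N, hN, rfl⟩
    by_contra hcon
    have hNk : k ≤ finrank F (range ((F ∙ y).mkQ ∘ₗ N)) := by
      change ¬ finrank F (range ((F ∙ y).mkQ ∘ₗ N)) ≤ k - 1 at hcon
      omega
    have hle : rowSpace A y ≤ (ker ((F ∙ y).mkQ ∘ₗ N)).dualAnnihilator := by
      intro ψ hψ
      rw [Submodule.mem_dualAnnihilator]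
      intro z hz
      have hz' : (F ∙ y).mkQ (N z) = 0 := hz
      have h1 := apply_eq_zero_of_mkQ_apply_eq_zero hA hN hNk hz'
      have hcomp : (F ∙ y).mkQ ∘ₗ (N + ψ.smulRight y) = (F ∙ y).mkQ ∘ₗ N := by
        ext x
        have : (F ∙ y).mkQ (ψ x • y) = 0 := mkQ_span_singleton_eq_zero.mpr ⟨_, rfl⟩
        rw [LinearMap.comp_apply, LinearMap.comp_apply, LinearMap.add_apply,
          LinearMap.smulRight_apply, map_add, this, add_zero]
      have h2 := apply_eq_zero_of_mkQ_apply_eq_zero (y := y) hA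
        (A.add_mem hN (mem_rowSpace.mp hψ)) (by rw [hcomp]; exact hNk) (z := z)
        (by rw [← LinearMap.comp_apply, hcomp]; exact hz)
      rw [LinearMap.add_apply, h1, zero_add, LinearMap.smulRight_apply] at h2
      exact (smul_eq_zero.mp h2).resolve_right hy
    have h3 := Submodule.finrank_mono hle
    have h4 := Subspace.finrank_add_finrank_dualAnnihilator_eq (ker ((F ∙ y).mkQ ∘ₗ N))
    have h5 := LinearMap.finrank_range_add_finrank_ker ((F ∙ y).mkQ ∘ₗ N)
    have h6 := hA N hN
    have h7 := Submodule.finrank_map_le (F ∙ y).mkQ (range N)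
    rw [← LinearMap.range_comp] at h7
    omega
  have hb := finrank_le_of_rank_le hrk
  have hq := finrank_quotient_span_singleton (F := F) hy
  rw [max_eq_left (by omega)] at hb
  have hsum := finrank_map_add_finrank_inf_ker
    (LinearMap.llcomp F V W (W ⧸ (F ∙ y)) (F ∙ y).mkQ) A
  have hs := finrank_inf_ker_mkQ_le A hy
  apply Submodule.eq_top_of_finrank_eq
  refine le_antisymm (Submodule.finrank_le _) ?_
  obtain ⟨j, rfl⟩ := Nat.exists_eq_add_of_le' hk
  rw [Nat.add_sub_cancel] at hb
  rw [mul_add, mul_one] at hdim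
  rw [Subspace.dual_finrank_eq]
  omega

end Extremal

end SumRank

namespace SumRank

open Module LinearMap

/-! ### Rank one maps as differences of injective maps. -/

section InjectiveMaps

variable {F : Type*} [Field F] {X Y : Type*} [AddCommGroup X] [Module F X]
  [AddCommGroup Y] [Module F Y] [FiniteDimensional F X] [FiniteDimensional F Y]

theorem exists_linearEquiv_apply_eq {u w : Y} (hu : u ≠ 0) (hw : w ≠ 0) :
    ∃ e : Y ≃ₗ[F] Y, e u = w := by
  obtain ⟨e, he⟩ := Submodule.exists_linearEquiv_restrict_eq
    ((LinearEquiv.toSpanNonzeroSingleton F Y u hu).symm ≪≫ₗ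
      LinearEquiv.toSpanNonzeroSingleton F Y w hw)
  refine ⟨e, ?_⟩
  have h := he (LinearEquiv.toSpanNonzeroSingleton F Y u hu 1)
  rw [LinearEquiv.trans_apply, LinearEquiv.symm_apply_apply] at h
  simpa using h.symm

/-- A map of rank one is injective or a difference of injective maps. -/
theorem injective_smulRight_or_exists (hXY : finrank F X ≤ finrank F Y) {φ : Dual F X}
    {w : Y} (hw : w ≠ 0) : Function.Injective (φ.smulRight w) ∨
      ∃ g : X →ₗ[F] Y, Function.Injective g ∧ Function.Injective (g + φ.smulRight w) := by
  by_cases hker : ker φ = ⊥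
  · left
    intro a b hab
    rw [LinearMap.smulRight_apply, LinearMap.smulRight_apply] at hab
    exact LinearMap.ker_eq_bot.mp hker (smul_left_injective F hw hab)
  · right
    obtain ⟨x, hx, hx0⟩ := (Submodule.ne_bot_iff _).mp hker
    obtain ⟨g₀, hg₀⟩ := finrank_le_iff_exists_linearMap.mp hXY
    obtain ⟨e, he⟩ := exists_linearEquiv_apply_eq (F := F)
      (fun h => hx0 (hg₀ (by rw [h, map_zero])) : g₀ x ≠ 0) hw
    -- With `g x = w`, the sum `g + w ⊗ φ` equals `g ∘ (1 + x ⊗ φ)`, and `1 + x ⊗ φ` is a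
    -- transvection because `φ x = 0`.
    refine ⟨e.toLinearMap ∘ₗ g₀, e.injective.comp hg₀, ?_⟩
    rw [injective_iff_map_eq_zero]
    intro a ha
    have h1 : e (g₀ (a + φ a • x)) = 0 := by
      rw [map_add, map_smul, map_add, map_smul, he]
      simpa using ha
    have h2 : a + φ a • x = 0 := hg₀ (by rw [map_zero]; exact e.map_eq_zero_iff.mp h1)
    have h3 : φ a = 0 := by
      have := congrArg φ h2
      simpa [LinearMap.mem_ker.mp hx] using this
    simpa [h3] using h2

end InjectiveMaps

/-! ### Extremal spaces that contain a rank one map. -/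

section RankOneElement

variable {F : Type*} [Field F] [Finite F] {V W : Type*} [AddCommGroup V] [Module F V]
  [AddCommGroup W] [Module F W] [FiniteDimensional F V] [FiniteDimensional F W]
  {k : ℕ} {A : Submodule F (V →ₗ[F] W)}

/-- The maps carrying a hyperplane `ker φ` into the line spanned by `y`. -/
noncomputable def hookSpace (φ : Dual F V) (y : W) : Submodule F (V →ₗ[F] W) :=
  ker ((LinearMap.llcomp F (ker φ) W (W ⧸ (F ∙ y)) (F ∙ y).mkQ) ∘ₗ
    (LinearMap.lcomp F W (ker φ).subtype))

theorem mkQ_apply_eq_zero_of_mem_hookSpace {φ : Dual F V} {y : W} {N : V →ₗ[F] W}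
    (hN : N ∈ hookSpace φ y) {x : V} (hx : φ x = 0) : (F ∙ y).mkQ (N x) = 0 :=
  congrArg (fun f => f ⟨x, hx⟩) (LinearMap.mem_ker.mp hN)

/-- Compressions `ker φ → W/⟨y⟩` of elements of `A` have rank at most `k - 1`, so they span at most
`(dim W - 1)(k - 1)` dimensions; the rest of `A` lies in the hook space. -/
theorem le_finrank_inf_hookSpace (hVW : finrank F V ≤ finrank F W)
    (hA : ∀ N ∈ A, finrank F (range N) ≤ k) (hdim : finrank F A = finrank F W * k)
    (hk : 1 ≤ k) {y : W} (hy : y ≠ 0) {φ : Dual F V} (hφ : φ ≠ 0) (hyφ : φ.smulRight y ∈ A) :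
    finrank F W + k ≤ finrank F ↥(A ⊓ hookSpace φ y) + 1 := by
  have hrk : ∀ M ∈ A.map ((LinearMap.llcomp F (ker φ) W (W ⧸ (F ∙ y)) (F ∙ y).mkQ) ∘ₗ
      (LinearMap.lcomp F W (ker φ).subtype)), finrank F (range M) ≤ k - 1 := by
    rintro _ ⟨N, hN, rfl⟩
    have := rank_compress_add_one_le hA hy hφ hyφ hN
    change finrank F (range ((F ∙ y).mkQ ∘ₗ N ∘ₗ (ker φ).subtype)) ≤ k - 1
    omega
  have hb := finrank_le_of_rank_le hrk
  have hq := finrank_quotient_span_singleton (F := F) hy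
  have hker := finrank_ker_add_one hφ
  rw [max_eq_right (by omega)] at hb
  have hsum := finrank_map_add_finrank_inf_ker
    ((LinearMap.llcomp F (ker φ) W (W ⧸ (F ∙ y)) (F ∙ y).mkQ) ∘ₗ
      (LinearMap.lcomp F W (ker φ).subtype)) A
  change _ + finrank F ↥(A ⊓ hookSpace φ y) = _ at hsum
  obtain ⟨j, rfl⟩ := Nat.exists_eq_add_of_le' hk
  rw [Nat.add_sub_cancel] at hb
  rw [← hq] at hdim ⊢
  have : (finrank F (W ⧸ F ∙ y) + 1) * (j + 1) =
    finrank F (W ⧸ F ∙ y) * j + finrank F (W ⧸ F ∙ y) + j + 1 := by ring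
  omega

/-- Restricting `A ∩ hookSpace φ y` to `ker φ` gives maps `y ⊗ θ`, at most `dim V - 1` dimensions,
with kernel of dimension at most `k`. Compared with the lower bound `dim W + k - 1`, this gives `dim
W ≤ dim V`. -/
theorem finrank_eq_of_columnSpace_le (hVW : finrank F V ≤ finrank F W)
    (hA : ∀ N ∈ A, finrank F (range N) ≤ k) (hdim : finrank F A = finrank F W * k)
    (hk : 1 ≤ k) {y : W} (hy : y ≠ 0) {φ : Dual F V} (hφ : φ ≠ 0) (hyφ : φ.smulRight y ∈ A)
    (hcol : finrank F (columnSpace A φ) ≤ k) : finrank F V = finrank F W := by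
  have hK := le_finrank_inf_hookSpace hVW hA hdim hk hy hφ hyφ
  have hsum := finrank_map_add_finrank_inf_ker (LinearMap.lcomp F W (ker φ).subtype)
    (A ⊓ hookSpace φ y)
  have h1 : finrank F ↥((A ⊓ hookSpace φ y) ⊓ ker (LinearMap.lcomp F W (ker φ).subtype)) ≤ k :=
    ((Submodule.finrank_mono (inf_le_inf_right _ inf_le_left)).trans
      (finrank_inf_ker_restrict_le A hφ)).trans hcol
  have h2 : (A ⊓ hookSpace φ y).map (LinearMap.lcomp F W (ker φ).subtype) ≤
      range ((LinearMap.smulRightₗ (R := F) (M := W) (M₂ := ker φ)).flip y) := by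
    rintro _ ⟨N, ⟨-, hN⟩, rfl⟩
    obtain ⟨θ, hθ⟩ := exists_eq_smulRight_of_mkQ_eq_zero hy
      (N := LinearMap.lcomp F W (ker φ).subtype N)
      (fun x => mkQ_apply_eq_zero_of_mem_hookSpace hN x.2)
    exact ⟨θ, hθ.symm⟩
  have h3 := Submodule.finrank_mono h2
  have h4 := LinearMap.finrank_range_le
    ((LinearMap.smulRightₗ (R := F) (M := W) (M₂ := ker φ)).flip y)
  rw [Subspace.dual_finrank_eq] at h4
  have h5 := finrank_ker_add_one hφ
  omega

/-- Modulo `y`, elements of `A ∩ hookSpace φ y` become `z ⊗ φ` with `z ∈ W/⟨y⟩`. The count is tight: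
the row space has dimension exactly `k` and every such `z ⊗ φ` is attained. -/
theorem rowSpace_lift (hVW : finrank F V ≤ finrank F W)
    (hA : ∀ N ∈ A, finrank F (range N) ≤ k) (hdim : finrank F A = finrank F W * k)
    (hk : 1 ≤ k) {y : W} (hy : y ≠ 0) {φ : Dual F V} (hφ : φ ≠ 0) (hyφ : φ.smulRight y ∈ A)
    (hrow : finrank F (rowSpace A y) ≤ k) :
    finrank F (rowSpace A y) = k ∧ ∀ z : W, ∃ θ : Dual F V,
      φ.smulRight z + θ.smulRight y ∈ A := by
  obtain ⟨v, hv⟩ := exists_dual_apply_eq_one hφ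
  have hK := le_finrank_inf_hookSpace hVW hA hdim hk hy hφ hyφ
  have hsum := finrank_map_add_finrank_inf_ker
    (LinearMap.llcomp F V W (W ⧸ (F ∙ y)) (F ∙ y).mkQ) (A ⊓ hookSpace φ y)
  have h1 : finrank F ↥((A ⊓ hookSpace φ y) ⊓
      ker (LinearMap.llcomp F V W (W ⧸ (F ∙ y)) (F ∙ y).mkQ)) ≤ finrank F (rowSpace A y) :=
    (Submodule.finrank_mono (inf_le_inf_right _ inf_le_left)).trans (finrank_inf_ker_mkQ_le A hy)
  have h2 : (A ⊓ hookSpace φ y).map (LinearMap.llcomp F V W (W ⧸ (F ∙ y)) (F ∙ y).mkQ) ≤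
      range (LinearMap.smulRightₗ (R := F) (M := W ⧸ (F ∙ y)) (M₂ := V) φ) := by
    rintro _ ⟨N, ⟨-, hN⟩, rfl⟩
    have h := eq_smulRight_of_vanish_on_ker hv
      (N := LinearMap.llcomp F V W (W ⧸ (F ∙ y)) (F ∙ y).mkQ N)
      (fun x hx => mkQ_apply_eq_zero_of_mem_hookSpace hN hx)
    exact ⟨_, h.symm⟩
  have h4 := LinearMap.finrank_range_le
    (LinearMap.smulRightₗ (R := F) (M := W ⧸ (F ∙ y)) (M₂ := V) φ)
  have hq := finrank_quotient_span_singleton (F := F) hy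
  have h3 := Submodule.finrank_mono h2
  refine ⟨by omega, fun z => ?_⟩
  have heq := Submodule.eq_of_le_of_finrank_le h2 (by omega)
  have hz : φ.smulRight ((F ∙ y).mkQ z) ∈
      (A ⊓ hookSpace φ y).map (LinearMap.llcomp F V W (W ⧸ (F ∙ y)) (F ∙ y).mkQ) := by
    rw [heq]
    exact ⟨_, rfl⟩
  obtain ⟨N, ⟨hNA, -⟩, hN⟩ := hz
  obtain ⟨θ, hθ⟩ := exists_eq_smulRight_of_mkQ_eq_zero hy (N := N - φ.smulRight z) (fun x => by
    have hx : (F ∙ y).mkQ (N x) = φ x • (F ∙ y).mkQ z := congrArg (fun f => f x) hN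
    rw [LinearMap.sub_apply, LinearMap.smulRight_apply, map_sub, map_smul, hx, sub_self])
  refine ⟨θ, ?_⟩
  rwa [← hθ, add_sub_cancel]

/-- Maps vanishing on a subspace are sums of rank one maps vanishing on it. -/
theorem mem_of_vanishing {U : Submodule F V} {P : Submodule F (V →ₗ[F] W)}
    (hP : ∀ φ ∈ U.dualAnnihilator, ∀ z : W, φ.smulRight z ∈ P) {N : V →ₗ[F] W}
    (hN : U ≤ ker N) : N ∈ P := by
  let b := Module.finBasis F (V ⧸ U)
  have h : N = ∑ i, (b.coord i ∘ₗ U.mkQ).smulRight (U.liftQ N hN (b i)) := by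
    ext x
    have h1 : U.liftQ N hN (U.mkQ x) = N x := by simp
    rw [← h1]
    conv_lhs => rw [← b.sum_repr (U.mkQ x)]
    rw [map_sum, LinearMap.sum_apply]
    exact Finset.sum_congr rfl fun i _ => map_smul _ _ _
  rw [h]
  refine P.sum_mem fun i _ => hP _ ?_ _
  rw [Submodule.mem_dualAnnihilator]
  intro w hw
  have : U.mkQ w = 0 := by simpa using hw
  rw [LinearMap.comp_apply, this, map_zero]

/-- A maximal space of maps of bounded rank with a rank one element contains all the maps
`y ⊗ φ` for a fixed `φ` or for a fixed `y`. -/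
theorem columnSpace_or_rowSpace_eq_top_of_mem (hVW : finrank F V ≤ finrank F W)
    (hA : ∀ N ∈ A, finrank F (range N) ≤ k) (hdim : finrank F A = finrank F W * k)
    (hk : 1 ≤ k) (hkV : k < finrank F V) {y : W} (hy : y ≠ 0) {φ : Dual F V} (hφ : φ ≠ 0)
    (hyφ : φ.smulRight y ∈ A) :
    (∃ ψ : Dual F V, ψ ≠ 0 ∧ columnSpace A ψ = ⊤) ∨
      (finrank F V = finrank F W ∧ ∃ z : W, z ≠ 0 ∧ rowSpace A z = ⊤) := by
  by_contra hcon
  rw [not_or] at hcon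
  obtain ⟨hc, hr⟩ := hcon
  have hcol : ∀ ψ : Dual F V, ψ ≠ 0 → finrank F (columnSpace A ψ) ≤ k := fun ψ hψ => by
    by_contra h
    exact hc ⟨ψ, hψ, columnSpace_eq_top_of_lt hVW hA hdim hk hψ (not_le.mp h)⟩
  have hnm := finrank_eq_of_columnSpace_le hVW hA hdim hk hy hφ hyφ (hcol φ hφ)
  have hrow : ∀ z : W, z ≠ 0 → finrank F (rowSpace A z) ≤ k := fun z hz => by
    by_contra h
    exact hr ⟨hnm, z, hz, rowSpace_eq_top_of_lt hnm.ge hA (by rw [hdim, hnm]) hk hz (not_le.mp h)⟩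
  have hrk : finrank F (rowSpace A y) = k :=
    (rowSpace_lift hVW hA hdim hk hy hφ hyφ (hrow y hy)).1
  -- The common kernel of the rows `ψ` with `y ⊗ ψ ∈ A`, of codimension `k`. The contradiction will
  -- be that `A` contains every `u ⊗ φ`.
  set U := (rowSpace A y).dualCoannihilator with hU
  have hUann : U.dualAnnihilator = rowSpace A y := Subspace.dualCoannihilator_dualAnnihilator_eq
  have hlift : ∀ N : V →ₗ[F] W, U ≤ ker N → ∃ θ : Dual F V, N + θ.smulRight y ∈ A := by
    intro N hN
    have hmem : N ∈ A ⊔ range ((LinearMap.smulRightₗ (R := F) (M := W) (M₂ := V)).flip y) := by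
      refine mem_of_vanishing (fun ψ hψ z => ?_) hN
      rw [hUann] at hψ
      by_cases hψ0 : ψ = 0
      · rw [hψ0, LinearMap.zero_smulRight]
        exact Submodule.zero_mem _
      · obtain ⟨θ, hθ⟩ := (rowSpace_lift hVW hA hdim hk hy hψ0 hψ (hrow y hy)).2 z
        refine Submodule.mem_sup.mpr ⟨_, hθ, _, ⟨-θ, rfl⟩, ?_⟩
        ext x
        simp
    obtain ⟨M, hM, _, ⟨θ, rfl⟩, rfl⟩ := Submodule.mem_sup.mp hmem
    refine ⟨-θ, ?_⟩
    convert! hM using 1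
    ext x
    simp
  -- The correction `y ⊗ θ` from `hlift` can be dropped when `N` has rank `k` modulo `y`: then the
  -- corrected map vanishes on `U` too, so `θ` annihilates `U` and `y ⊗ θ` is itself in `A`.
  have hfull : ∀ N : V →ₗ[F] W, U ≤ ker N → k ≤ finrank F (range ((F ∙ y).mkQ ∘ₗ N)) → N ∈ A := by
    intro N hNU hNk
    obtain ⟨θ, hθ⟩ := hlift N hNU
    have hcomp : (F ∙ y).mkQ ∘ₗ (N + θ.smulRight y) = (F ∙ y).mkQ ∘ₗ N := by
      ext x
      have : (F ∙ y).mkQ (θ x • y) = 0 := mkQ_span_singleton_eq_zero.mpr ⟨_, rfl⟩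
      rw [LinearMap.comp_apply, LinearMap.comp_apply, LinearMap.add_apply,
        LinearMap.smulRight_apply, map_add, this, add_zero]
    have hθU : θ ∈ rowSpace A y := by
      rw [← hUann, Submodule.mem_dualAnnihilator]
      intro u hu
      have hNu : N u = 0 := hNU hu
      have h := apply_eq_zero_of_mkQ_apply_eq_zero (y := y) hA hθ (by rw [hcomp]; exact hNk)
        (z := u) (by rw [← LinearMap.comp_apply, hcomp, LinearMap.comp_apply, hNu, map_zero])
      rw [LinearMap.add_apply, hNu, zero_add, LinearMap.smulRight_apply] at h
      exact (smul_eq_zero.mp h).resolve_right hy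
    have := A.sub_mem hθ (mem_rowSpace.mp hθU)
    rwa [add_sub_cancel_right] at this
  have hUdim : finrank F (V ⧸ U) = k := by
    have h1 := Submodule.finrank_quotient_add_finrank U
    have h2 := Subspace.finrank_add_finrank_dualCoannihilator_eq (rowSpace A y)
    rw [← hU] at h2
    omega
  have hq := finrank_quotient_span_singleton (F := F) hy
  obtain ⟨s, hs⟩ := LinearMap.exists_rightInverse_of_surjective (F ∙ y).mkQ
    (Submodule.range_mkQ _)
  have hinj : ∀ (g : V ⧸ U →ₗ[F] W ⧸ (F ∙ y)), Function.Injective g → ∀ N : V →ₗ[F] W,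
      U ≤ ker N → (F ∙ y).mkQ ∘ₗ N = g ∘ₗ U.mkQ → N ∈ A := by
    intro g hg N hNU hN
    refine hfull N hNU ?_
    rw [hN, LinearMap.range_comp_of_range_eq_top _ (Submodule.range_mkQ _),
      LinearMap.finrank_range_of_inj hg, hUdim]
  have hφU : U ≤ ker φ := by
    have : φ ∈ U.dualAnnihilator := by rw [hUann]; exact hyφ
    exact fun u hu => (Submodule.mem_dualAnnihilator φ).mp this u hu
  -- By `hinj`, lifts of injective maps `V/U → W/⟨y⟩` lie in `A`; the map induced by `u ⊗ φ` is
  -- injective or a difference of two injective ones.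
  have htop : columnSpace A φ = ⊤ := by
    rw [eq_top_iff]
    rintro u -
    rw [mem_columnSpace]
    by_cases hu : (F ∙ y).mkQ u = 0
    · obtain ⟨c, rfl⟩ := mkQ_span_singleton_eq_zero.mp hu
      have : φ.smulRight (c • y) = c • φ.smulRight y := by
        ext x
        simp [smul_smul, mul_comm]
      rw [this]
      exact A.smul_mem c hyφ
    · have hker : U ≤ ker (φ.smulRight u) := fun x hx => by
        have : φ x = 0 := hφU hx
        simp [this]
      have hcomp : (F ∙ y).mkQ ∘ₗ φ.smulRight u =
          ((U.liftQ φ hφU).smulRight ((F ∙ y).mkQ u)) ∘ₗ U.mkQ := by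
        ext x
        simp
      rcases injective_smulRight_or_exists (φ := U.liftQ φ hφU)
        (by omega : finrank F (V ⧸ U) ≤ finrank F (W ⧸ (F ∙ y))) hu with hg | ⟨g, hg, hg'⟩
      · exact hinj _ hg _ hker hcomp
      · have hN1 : (F ∙ y).mkQ ∘ₗ (s ∘ₗ g ∘ₗ U.mkQ) = g ∘ₗ U.mkQ := by
          rw [← LinearMap.comp_assoc, hs, LinearMap.id_comp]
        have hNker : U ≤ ker (s ∘ₗ g ∘ₗ U.mkQ) := fun x hx => by
          have : U.mkQ x = 0 := by simpa using hx
          rw [LinearMap.mem_ker, LinearMap.comp_apply, LinearMap.comp_apply, this, map_zero,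
            map_zero]
        have h1 := hinj g hg _ hNker hN1
        have h2 := hinj _ hg' (s ∘ₗ g ∘ₗ U.mkQ + φ.smulRight u)
          (fun x hx => by
            rw [LinearMap.mem_ker, LinearMap.add_apply, LinearMap.mem_ker.mp (hNker hx),
              LinearMap.mem_ker.mp (hker hx), add_zero])
          (by rw [LinearMap.comp_add, hN1, hcomp, LinearMap.add_comp])
        have := A.sub_mem h2 h1
        rwa [add_sub_cancel_left] at this
  exact hc ⟨φ, hφ, htop⟩

end RankOneElement

end SumRank

namespace SumRank

open Module LinearMap

/-! ### The orthogonal as a space of maps between dual spaces. -/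

section DualSpace

variable {F : Type*} [Field F] {V W : Type*} [AddCommGroup V] [Module F V]
  [AddCommGroup W] [Module F W] [FiniteDimensional F V] [FiniteDimensional F W]
  {k : ℕ} {A : Submodule F (V →ₗ[F] W)}

/-- The orthogonal of a space of maps `V → W`, as a space of maps between the dual spaces. -/
noncomputable def dualSpace (A : Submodule F (V →ₗ[F] W)) :
    Submodule F (Dual F V →ₗ[F] Dual F W) :=
  traceOrthogonal (transposeSpace A)

theorem smulRight_mem_dualSpace {ξ : Dual F (Dual F V)} {η : Dual F W} :
    ξ.smulRight η ∈ dualSpace A ↔ ∀ N ∈ A, ξ (η ∘ₗ N) = 0 := by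
  rw [dualSpace, mem_traceOrthogonal, transposeSpace]
  have h : ∀ N : V →ₗ[F] W, LinearMap.trace F (Dual F W)
      (ξ.smulRight η ∘ₗ Dual.transpose (R := F) N) = ξ (η ∘ₗ N) := by
    intro N
    have : ξ.smulRight η ∘ₗ Dual.transpose (R := F) N =
        (ξ ∘ₗ Dual.transpose (R := F) N).smulRight η := by
      ext x
      simp
    rw [this, LinearMap.trace_smulRight]
    rfl
  constructor
  · intro hN N hNA
    rw [← h]
    exact hN _ ⟨N, hNA, rfl⟩
  · rintro hN _ ⟨N, hNA, rfl⟩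
    rw [h]
    exact hN N hNA

/-- A full column or row space of the orthogonal is a linear condition on all of `A`: writing `ξ` as
evaluation at `x`, it says `η (N x) = 0` for every `η`; in the other case `ξ (η ∘ N) = 0` for every
`ξ`. -/
theorem exists_kernel_of_dualSpace
    (h : (∃ ξ : Dual F (Dual F V), ξ ≠ 0 ∧ columnSpace (dualSpace A) ξ = ⊤) ∨
      (finrank F (Dual F V) = finrank F (Dual F W) ∧
        ∃ η : Dual F W, η ≠ 0 ∧ rowSpace (dualSpace A) η = ⊤)) :
    (∃ x : V, x ≠ 0 ∧ ∀ N ∈ A, N x = 0) ∨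
      (finrank F V = finrank F W ∧ ∃ η : Dual F W, η ≠ 0 ∧ ∀ N ∈ A, η ∘ₗ N = 0) := by
  rcases h with ⟨ξ, hξ, h⟩ | ⟨hd, η, hη, h⟩
  · left
    obtain ⟨x, rfl⟩ := (Module.evalEquiv F V).surjective ξ
    refine ⟨x, by rintro rfl; simp at hξ, fun N hN => ?_⟩
    rw [← Module.forall_dual_apply_eq_zero_iff F]
    intro η
    have hη : η ∈ columnSpace (dualSpace A) (Module.evalEquiv F V x) := by rw [h]; trivial
    have := smulRight_mem_dualSpace.mp (mem_columnSpace.mp hη) N hN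
    simpa using this
  · right
    rw [Subspace.dual_finrank_eq, Subspace.dual_finrank_eq] at hd
    refine ⟨hd, η, hη, fun N hN => ?_⟩
    rw [← Module.forall_dual_apply_eq_zero_iff F]
    intro ξ
    have hξ : ξ ∈ rowSpace (dualSpace A) η := by rw [h]; trivial
    exact smulRight_mem_dualSpace.mp (mem_rowSpace.mp hξ) N hN

variable [Finite F]

theorem rank_le_of_mem_dualSpace (hVW : finrank F V ≤ finrank F W)
    (hA : ∀ N ∈ A, finrank F (range N) ≤ k) (hdim : finrank F A = finrank F W * k)
    (hk : k ≤ finrank F V) : ∀ D ∈ dualSpace A, finrank F (range D) ≤ finrank F V - k := by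
  intro D hD
  have := rank_add_le_of_mem_traceOrthogonal (V := Dual F V) (W := Dual F W) (k := k)
    (by rwa [Subspace.dual_finrank_eq, Subspace.dual_finrank_eq])
    (by rwa [Subspace.dual_finrank_eq]) (rank_le_of_mem_transposeSpace hA)
    (by rw [finrank_transposeSpace, Subspace.dual_finrank_eq, hdim]) hD
  rw [Subspace.dual_finrank_eq] at this
  omega

theorem finrank_dualSpace (hdim : finrank F A = finrank F W * k) :
    finrank F (dualSpace A) = finrank F W * (finrank F V - k) := by
  have := finrank_add_finrank_traceOrthogonal (transposeSpace A)
  rw [finrank_transposeSpace, Subspace.dual_finrank_eq, Subspace.dual_finrank_eq, hdim] at this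
  rw [dualSpace, Nat.mul_sub, mul_comm _ (finrank F V)]
  omega

/-- A map of rank at most one is of the form `y ⊗ φ`. -/
theorem exists_eq_smulRight_of_rank_le_one {N : V →ₗ[F] W} (hN : N ≠ 0)
    (h : finrank F (range N) ≤ 1) : ∃ (φ : Dual F V) (y : W), φ ≠ 0 ∧ y ≠ 0 ∧
      N = φ.smulRight y := by
  obtain ⟨x, hx⟩ : ∃ x, N x ≠ 0 := by
    by_contra hcon
    push Not at hcon
    exact hN (LinearMap.ext hcon)
  have hle : F ∙ N x ≤ range N := (Submodule.span_singleton_le_iff_mem _ _).mpr ⟨x, rfl⟩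
  have heq := Submodule.eq_of_le_of_finrank_le hle (by rwa [finrank_span_singleton hx])
  obtain ⟨φ, hφ⟩ := exists_eq_smulRight_of_mkQ_eq_zero hx (N := N) (fun z => by
    rw [Submodule.mkQ_apply, Submodule.Quotient.mk_eq_zero, heq]
    exact ⟨z, rfl⟩)
  refine ⟨φ, N x, ?_, hx, hφ⟩
  rintro rfl
  rw [LinearMap.zero_smulRight] at hφ
  exact hN hφ

end DualSpace

/-! ### Structure of extremal spaces and descent by one rank. -/

section Structure

universe u

variable {F : Type u} [Field F] [Finite F]

/-- If all maps in `A` kill `x`, then `A` comes from a space of maps on the quotient by `x`. -/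
theorem exists_columnSpace_eq_top_of_quotient {V W : Type*} [AddCommGroup V] [Module F V]
    [AddCommGroup W] [Module F W] [FiniteDimensional F V] [FiniteDimensional F W]
    {k : ℕ} {A : Submodule F (V →ₗ[F] W)} {x : V} (hx : ∀ N ∈ A, N x = 0)
    (ih : ∀ B : Submodule F (V ⧸ (F ∙ x) →ₗ[F] W),
      (∀ N ∈ B, finrank F (range N) ≤ k) → finrank F B = finrank F W * k →
      ∃ ψ : Dual F (V ⧸ (F ∙ x)), ψ ≠ 0 ∧ columnSpace B ψ = ⊤)
    (hA : ∀ N ∈ A, finrank F (range N) ≤ k) (hdim : finrank F A = finrank F W * k) :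
    ∃ ψ : Dual F V, ψ ≠ 0 ∧ columnSpace A ψ = ⊤ := by
  have hsurj := Submodule.range_mkQ (F ∙ x)
  have hinj : Function.Injective (LinearMap.lcomp F W (F ∙ x).mkQ) := by
    intro N N' h
    exact (LinearMap.cancel_right (LinearMap.range_eq_top.mp hsurj)).mp h
  obtain ⟨ψ, hψ0, hψ⟩ := ih (A.comap (LinearMap.lcomp F W (F ∙ x).mkQ))
    (fun N hN => by
      have h := hA _ hN
      change finrank F (range (N ∘ₗ (F ∙ x).mkQ)) ≤ k at h
      rwa [LinearMap.range_comp_of_range_eq_top _ hsurj] at h)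
    (by
      rw [← hdim, (Submodule.equivMapOfInjective _ hinj _).finrank_eq, Submodule.map_comap_eq,
        inf_eq_right.mpr]
      intro N hN
      have hle : F ∙ x ≤ ker N := (Submodule.span_singleton_le_iff_mem _ _).mpr (hx N hN)
      exact ⟨(F ∙ x).liftQ N hle, Submodule.liftQ_mkQ (F ∙ x) N hle⟩)
  refine ⟨ψ ∘ₗ (F ∙ x).mkQ, ?_, ?_⟩
  · intro h
    apply hψ0
    exact (LinearMap.cancel_right (LinearMap.range_eq_top.mp hsurj)).mp
      (h.trans (LinearMap.zero_comp _).symm)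
  · rw [eq_top_iff]
    rintro y -
    have hy : y ∈ columnSpace (A.comap (LinearMap.lcomp F W (F ∙ x).mkQ)) ψ := by
      rw [hψ]; trivial
    exact hy

/-- A maximal space of maps of rank at most `k` contains all maps `y ⊗ φ` for a fixed `φ ≠ 0`,
or, in the square case, for a fixed `y ≠ 0`. -/
theorem exists_columnSpace_or_rowSpace_eq_top (n : ℕ) : ∀ {V W : Type u} [AddCommGroup V]
    [Module F V] [AddCommGroup W] [Module F W] [FiniteDimensional F V] [FiniteDimensional F W]
    {k : ℕ} {A : Submodule F (V →ₗ[F] W)}, finrank F V = n → finrank F V ≤ finrank F W →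
    (∀ N ∈ A, finrank F (range N) ≤ k) → finrank F A = finrank F W * k → 1 ≤ k →
    k ≤ finrank F V →
    (∃ ψ : Dual F V, ψ ≠ 0 ∧ columnSpace A ψ = ⊤) ∨
      (finrank F V = finrank F W ∧ ∃ z : W, z ≠ 0 ∧ rowSpace A z = ⊤) := by
  induction n with
  | zero => intros; omega
  | succ n ih =>
    intro V W _ _ _ _ _ _ k A hn hVW hA hdim hk hkV
    obtain ⟨v, hv⟩ : ∃ v : V, v ≠ 0 := by
      have : Nontrivial V := Module.nontrivial_of_finrank_pos (R := F) (by omega)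
      exact exists_ne 0
    obtain ⟨φ, hφv⟩ : ∃ φ : Dual F V, φ v ≠ 0 := by
      by_contra hcon
      push Not at hcon
      exact hv ((Module.forall_dual_apply_eq_zero_iff F v).mp hcon)
    have hφ : φ ≠ 0 := by rintro rfl; simp at hφv
    by_cases hkn : k = finrank F V
    · left
      have htop : A = ⊤ := by
        apply Submodule.eq_top_of_finrank_eq
        rw [hdim, Module.finrank_linearMap, hkn, mul_comm]
      refine ⟨φ, hφ, ?_⟩
      rw [htop, columnSpace, Submodule.comap_top]
    have hkV' : k < finrank F V := lt_of_le_of_ne hkV hkn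
    by_cases hone : ∃ (ψ : Dual F V) (y : W), ψ ≠ 0 ∧ y ≠ 0 ∧ ψ.smulRight y ∈ A
    · obtain ⟨ψ, y, hψ, hy, h⟩ := hone
      exact columnSpace_or_rowSpace_eq_top_of_mem hVW hA hdim hk hkV' hy hψ h
    -- Over `V/⟨x⟩` the situation is strictly non-square, so induction can only return the column
    -- alternative.
    have hquot : ∀ x : V, x ≠ 0 → (∀ N ∈ A, N x = 0) →
        ∃ ψ : Dual F V, ψ ≠ 0 ∧ columnSpace A ψ = ⊤ := by
      intro x hx0 hx
      have hq := finrank_quotient_span_singleton (F := F) hx0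
      refine exists_columnSpace_eq_top_of_quotient hx (fun B hB hBdim => ?_) hA hdim
      rcases ih (A := B) (by omega) (by omega) hB hBdim hk (by omega) with h | ⟨h, -⟩
      · exact h
      · omega
    -- In this case the orthogonal has rank bound `1`, so it has a rank one element even though `A`
    -- has none.
    by_cases hkn' : k + 1 = finrank F V
    · have hrk := rank_le_of_mem_dualSpace hVW hA hdim hkV
      have hdd := finrank_dualSpace hdim
      have h1 : finrank F V - k = 1 := by omega
      rw [h1] at hrk hdd
      obtain ⟨D, hD, hD0⟩ : ∃ D ∈ dualSpace A, D ≠ 0 := by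
        apply (Submodule.ne_bot_iff _).mp
        intro h
        rw [h, finrank_bot] at hdd
        omega
      obtain ⟨ξ, η, hξ, hη, rfl⟩ := exists_eq_smulRight_of_rank_le_one hD0 (hrk D hD)
      have := columnSpace_or_rowSpace_eq_top_of_mem (A := dualSpace A)
        (by rwa [Subspace.dual_finrank_eq, Subspace.dual_finrank_eq]) hrk
        (by rw [hdd, Subspace.dual_finrank_eq]) le_rfl
        (by rw [Subspace.dual_finrank_eq]; omega) hη hξ hD
      rcases exists_kernel_of_dualSpace this with ⟨x, hx0, hx⟩ | ⟨hnm, η, hη0, hη⟩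
      · exact Or.inl (hquot x hx0 hx)
      · right
        refine ⟨hnm, ?_⟩
        obtain ⟨w, hw⟩ := LinearMap.surjective_of_ne_zero hη0 1
        let T : (V →ₗ[F] W) →ₗ[F] (V →ₗ[F] F) := LinearMap.llcomp F V W F η
        have hsurj : Function.Surjective T := by
          intro θ
          refine ⟨θ.smulRight w, ?_⟩
          ext x
          simp [T, hw]
        -- The dimensions `dim W * k` and `dim V * dim W - dim V` agree because `dim V = dim W = k +
        -- 1`; any nonzero `z ∈ ker η` then works.
        have hAeq : A = ker T := by
          refine Submodule.eq_of_le_of_finrank_le (fun N hN => LinearMap.mem_ker.mpr (hη N hN)) ?_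
          have h := LinearMap.finrank_range_add_finrank_ker T
          rw [LinearMap.range_eq_top.mpr hsurj, finrank_top, Subspace.dual_finrank_eq,
            Module.finrank_linearMap, ← hkn', add_mul, one_mul, mul_comm k] at h
          omega
        have hker := finrank_ker_add_one hη0
        obtain ⟨z, hz, hz0⟩ := (Submodule.ne_bot_iff (ker η)).mp (by
          intro h
          rw [h, finrank_bot] at hker
          omega)
        refine ⟨z, hz0, ?_⟩
        rw [eq_top_iff]
        rintro θ -
        rw [mem_rowSpace, hAeq, LinearMap.mem_ker]
        ext x
        simp [T, LinearMap.mem_ker.mp hz]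
    · left
      have hker := finrank_ker_add_one hφ
      -- Restriction to the hyperplane is injective on `A`, since its kernel would consist of maps
      -- `y ⊗ φ`. Induction applies to the orthogonal of `B`, whose rank bound `dim V - 1 - k` is
      -- positive here; a vector killed by `B` is killed by `A`.
      set B := A.map (LinearMap.lcomp F W (ker φ).subtype) with hB
      have hBdim : finrank F B = finrank F W * k := by
        have h := finrank_map_add_finrank_inf_ker (LinearMap.lcomp F W (ker φ).subtype) A
        have h1 := finrank_inf_ker_restrict_le A hφ
        have h2 : columnSpace A φ = ⊥ := by
          rw [Submodule.eq_bot_iff]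
          intro y hy
          by_contra hy0
          exact hone ⟨φ, y, hφ, hy0, hy⟩
        rw [h2, finrank_bot] at h1
        rw [← hB] at h
        omega
      have hBrk : ∀ N ∈ B, finrank F (range N) ≤ k := by
        rintro _ ⟨N, hN, rfl⟩
        refine (Submodule.finrank_mono ?_).trans (hA N hN)
        rintro _ ⟨x, rfl⟩
        exact ⟨x, rfl⟩
      have hdual := ih (A := dualSpace B) (by rw [Subspace.dual_finrank_eq]; omega)
        (by rw [Subspace.dual_finrank_eq, Subspace.dual_finrank_eq]; omega)
        (rank_le_of_mem_dualSpace (by omega) hBrk hBdim (by omega))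
        (by rw [finrank_dualSpace hBdim, Subspace.dual_finrank_eq]) (by omega)
        (by rw [Subspace.dual_finrank_eq]; omega)
      rcases exists_kernel_of_dualSpace hdual with ⟨x, hx0, hx⟩ | ⟨h, -⟩
      · refine hquot x (fun h => hx0 (Subtype.ext h)) (fun N hN => ?_)
        exact hx _ ⟨N, hN, rfl⟩
      · omega

/-- Optimal anticodes contain optimal anticodes of the preceding rank. -/
theorem exists_le_rank_le_pred {V W : Type u} [AddCommGroup V]
    [Module F V] [AddCommGroup W] [Module F W] [FiniteDimensional F V] [FiniteDimensional F W]
    {k : ℕ} {A : Submodule F (V →ₗ[F] W)} (hVW : finrank F V ≤ finrank F W)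
    (hA : ∀ N ∈ A, finrank F (range N) ≤ k + 1) (hdim : finrank F A = finrank F W * (k + 1))
    (hk : k + 1 ≤ finrank F V) :
    ∃ B ≤ A, (∀ N ∈ B, finrank F (range N) ≤ k) ∧ finrank F B = finrank F W * k := by
  suffices h : ∃ B ≤ A, (∀ N ∈ B, finrank F (range N) ≤ k) ∧
      finrank F W * k ≤ finrank F B by
    obtain ⟨B, hBA, hB, hBdim⟩ := h
    exact ⟨B, hBA, hB, le_antisymm (finrank_le_of_rank_le_of_le hVW hB) hBdim⟩
  rcases exists_columnSpace_or_rowSpace_eq_top _ rfl hVW hA hdim (by omega) hk with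
    ⟨ψ, hψ, htop⟩ | ⟨hnm, z, hz, htop⟩
  · obtain ⟨v, hv⟩ := exists_dual_apply_eq_one hψ
    -- Vanishing at `v` costs at most `dim W` dimensions. If `N v = 0`, adding `u ⊗ ψ` with `u`
    -- outside the range of `N` raises the rank by one inside `A`, so `N` has rank at most `k`.
    refine ⟨A ⊓ ker (LinearMap.applyₗ v), inf_le_left, ?_, ?_⟩
    · rintro N ⟨hNA, hNv⟩
      have hNv' : N v = 0 := hNv
      have hrn := LinearMap.finrank_range_add_finrank_ker N
      have hker : 0 < finrank F (ker N) := by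
        rw [Module.finrank_pos_iff_exists_ne_zero]
        refine ⟨⟨v, hNv'⟩, fun h => ?_⟩
        have : v = 0 := congrArg Subtype.val h
        simp [this] at hv
      obtain ⟨u, -, hu⟩ := SetLike.exists_of_lt (lt_top_iff_ne_top.mpr (fun h => by
        rw [h, finrank_top] at hrn
        omega : range N ≠ ⊤))
      have hmem : N + ψ.smulRight u ∈ A := A.add_mem hNA (by
        have : u ∈ columnSpace A ψ := by rw [htop]; trivial
        exact this)
      have h := Submodule.finrank_sup_add_finrank_inf_eq (range N) (F ∙ u)
      rw [(Submodule.disjoint_span_singleton_of_notMem hu).eq_bot, finrank_bot,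
        finrank_span_singleton (by rintro rfl; exact hu (Submodule.zero_mem _))] at h
      have hle : range N ⊔ F ∙ u ≤ range (N + ψ.smulRight u) := by
        refine sup_le ?_ ((Submodule.span_singleton_le_iff_mem _ _).mpr ⟨v, by simp [hNv', hv]⟩)
        rintro _ ⟨x, rfl⟩
        exact ⟨x - ψ x • v, by simp [hNv', hv]⟩
      have h2 := Submodule.finrank_mono hle
      have h3 := hA _ hmem
      omega
    · have h := finrank_map_add_finrank_inf_ker (LinearMap.applyₗ (R := F) (M₂ := W) v) A
      have h2 := Submodule.finrank_le (A.map (LinearMap.applyₗ (R := F) (M₂ := W) v))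
      rw [hdim, mul_add, mul_one] at h
      omega
  · obtain ⟨η, hη⟩ : ∃ η : Dual F W, η z = 1 := by
      obtain ⟨η, hη⟩ : ∃ η : Dual F W, η z ≠ 0 := by
        by_contra hcon
        push Not at hcon
        exact hz ((Module.forall_dual_apply_eq_zero_iff F z).mp hcon)
      exact ⟨(η z)⁻¹ • η, by simp [hη]⟩
    -- The condition `η ∘ N = 0` costs at most `dim V = dim W` dimensions and keeps `z` out of the
    -- range. So `N` is not injective, and `z ⊗ θ` with `θ` nonzero on its kernel raises the rank.
    refine ⟨A ⊓ ker (LinearMap.llcomp F V W F η), inf_le_left, ?_, ?_⟩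
    · rintro N ⟨hNA, hNη⟩
      have hNη' : ∀ x, η (N x) = 0 := fun x =>
        congrArg (fun f => f x) (LinearMap.mem_ker.mp hNη)
      have hzN : z ∉ range N := by
        rintro ⟨x, hx⟩
        have := hNη' x
        rw [hx, hη] at this
        exact one_ne_zero this
      have hrn := LinearMap.finrank_range_add_finrank_ker N
      have h := Submodule.finrank_sup_add_finrank_inf_eq (range N) (F ∙ z)
      rw [(Submodule.disjoint_span_singleton_of_notMem hzN).eq_bot, finrank_bot,
        finrank_span_singleton hz] at h
      have h4 := Submodule.finrank_le (range N ⊔ F ∙ z)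
      obtain ⟨x, hx, hx0⟩ := (Submodule.ne_bot_iff (ker N)).mp (by
        intro h0
        rw [h0, finrank_bot] at hrn
        omega)
      obtain ⟨θ, hθ⟩ : ∃ θ : Dual F V, θ x ≠ 0 := by
        by_contra hcon
        push Not at hcon
        exact hx0 ((Module.forall_dual_apply_eq_zero_iff F x).mp hcon)
      have hmem : N + θ.smulRight z ∈ A := A.add_mem hNA (by
        have : θ ∈ rowSpace A z := by rw [htop]; trivial
        exact this)
      have hzr : z ∈ range (N + θ.smulRight z) :=
        ⟨(θ x)⁻¹ • x, by simp [LinearMap.mem_ker.mp hx, hθ]⟩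
      have hle : range N ⊔ F ∙ z ≤ range (N + θ.smulRight z) := by
        refine sup_le ?_ ((Submodule.span_singleton_le_iff_mem _ _).mpr hzr)
        rintro _ ⟨w, rfl⟩
        have h1 : N w = (N + θ.smulRight z) w - θ w • z := by simp
        rw [h1]
        exact Submodule.sub_mem _ ⟨w, rfl⟩ (Submodule.smul_mem _ _ hzr)
      have h2 := Submodule.finrank_mono hle
      have h3 := hA _ hmem
      omega
    · have h := finrank_map_add_finrank_inf_ker (LinearMap.llcomp F V W F η) A
      have h2 := Submodule.finrank_le (A.map (LinearMap.llcomp F V W F η))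
      rw [Subspace.dual_finrank_eq] at h2
      rw [hdim, mul_add, mul_one] at h
      omega

end Structure

end SumRank

namespace SumRank

open Module

/-! ### Optimal anticodes of matrices. -/

section MatrixAnticodes

universe u

variable {F : Type u} [Field F] {m n : ℕ}

/-- A space of `m × n` matrices of rank at most `k` and of dimension `m * k`. -/
def IsAnticodeOfRank (A : Submodule F (Matrix (Fin m) (Fin n) F)) (k : ℕ) : Prop :=
  (∀ M ∈ A, M.rank ≤ k) ∧ finrank F A = m * k

/-- The linear maps given by the matrices in `A`. -/
noncomputable def linSpace (A : Submodule F (Matrix (Fin m) (Fin n) F)) :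
    Submodule F ((Fin n → F) →ₗ[F] (Fin m → F)) :=
  A.map (Matrix.toLin' : Matrix (Fin m) (Fin n) F ≃ₗ[F] _).toLinearMap

theorem finrank_linSpace (A : Submodule F (Matrix (Fin m) (Fin n) F)) :
    finrank F (linSpace A) = finrank F A :=
  LinearEquiv.finrank_map_eq _ _

theorem rank_eq_finrank_range_toLin' (M : Matrix (Fin m) (Fin n) F) :
    finrank F (LinearMap.range (Matrix.toLin' M)) = M.rank := rfl

theorem rank_le_of_mem_linSpace {A : Submodule F (Matrix (Fin m) (Fin n) F)} {k : ℕ}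
    (hA : ∀ M ∈ A, M.rank ≤ k) : ∀ N ∈ linSpace A, finrank F (LinearMap.range N) ≤ k := by
  rintro _ ⟨M, hM, rfl⟩
  exact hA M hM

/-- The orthogonal of a space of matrices for the form `tr (D Cᵀ)`. -/
noncomputable def matrixDual (A : Submodule F (Matrix (Fin m) (Fin n) F)) :
    Submodule F (Matrix (Fin m) (Fin n) F) :=
  (traceOrthogonal (linSpace
    (A.map (Matrix.transposeLinearEquiv (Fin m) (Fin n) F F).toLinearMap))).comap
    (Matrix.toLin' : Matrix (Fin m) (Fin n) F ≃ₗ[F] _).toLinearMap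

theorem mem_matrixDual {A : Submodule F (Matrix (Fin m) (Fin n) F)}
    {D : Matrix (Fin m) (Fin n) F} :
    D ∈ matrixDual A ↔ ∀ C ∈ A, (D * C.transpose).trace = 0 := by
  have h : ∀ C : Matrix (Fin m) (Fin n) F, LinearMap.trace F _
      (Matrix.toLin' D ∘ₗ Matrix.toLin' C.transpose) = (D * C.transpose).trace := by
    intro C
    rw [← Matrix.toLin'_mul, Matrix.trace_toLin'_eq]
  rw [matrixDual, Submodule.mem_comap, mem_traceOrthogonal]
  constructor
  · intro hD C hC
    rw [← h]
    exact hD _ ⟨_, ⟨C, hC, rfl⟩, rfl⟩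
  · rintro hD _ ⟨_, ⟨C, hC, rfl⟩, rfl⟩
    exact (h C).trans (hD C hC)

theorem IsAnticodeOfRank.le [hm : NeZero m] {A : Submodule F (Matrix (Fin m) (Fin n) F)} {k : ℕ}
    (hA : IsAnticodeOfRank A k) : k ≤ n := by
  have h := Submodule.finrank_le A
  rw [hA.2, Module.finrank_matrix, Module.finrank_self, mul_one, Fintype.card_fin,
    Fintype.card_fin] at h
  exact Nat.le_of_mul_le_mul_left h (NeZero.pos m)

theorem isAnticodeOfRank_top : IsAnticodeOfRank (⊤ : Submodule F (Matrix (Fin m) (Fin n) F)) n := by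
  refine ⟨fun M _ => by simpa using M.rank_le_width, ?_⟩
  rw [finrank_top, Module.finrank_matrix, Module.finrank_self, mul_one, Fintype.card_fin,
    Fintype.card_fin]

variable [Finite F]

theorem finrank_le_of_matrix_rank_le (hnm : n ≤ m) {A : Submodule F (Matrix (Fin m) (Fin n) F)}
    {k : ℕ} (hA : ∀ M ∈ A, M.rank ≤ k) : finrank F A ≤ m * k := by
  have h := finrank_le_of_rank_le_of_le (by simpa using hnm) (rank_le_of_mem_linSpace hA)
  rwa [finrank_linSpace, Module.finrank_fin_fun] at h

theorem IsAnticodeOfRank.matrixDual [NeZero m] (hnm : n ≤ m)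
    {A : Submodule F (Matrix (Fin m) (Fin n) F)} {k : ℕ} (hA : IsAnticodeOfRank A k) :
    IsAnticodeOfRank (matrixDual A) (n - k) := by
  set B := linSpace (A.map (Matrix.transposeLinearEquiv (Fin m) (Fin n) F F).toLinearMap) with hB
  have hBdim : finrank F B = m * k := by
    rw [hB, finrank_linSpace, LinearEquiv.finrank_map_eq, hA.2]
  have hBrk : ∀ N ∈ B, finrank F (LinearMap.range N) ≤ k := by
    apply rank_le_of_mem_linSpace
    rintro _ ⟨M, hM, rfl⟩
    exact (Matrix.rank_transpose M).trans_le (hA.1 M hM)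
  refine ⟨fun D hD => ?_, ?_⟩
  · have h := rank_add_le_of_mem_traceOrthogonal (V := Fin n → F) (W := Fin m → F)
      (by simpa using hnm) (by simpa using hA.le) hBrk (by simpa using hBdim) hD
    rw [Module.finrank_fin_fun] at h
    have h2 := rank_eq_finrank_range_toLin' D
    change finrank F (LinearMap.range (Matrix.toLin' D)) + k ≤ n at h
    omega
  · have h := finrank_add_finrank_traceOrthogonal B
    rw [hBdim, Module.finrank_fin_fun, Module.finrank_fin_fun] at h
    have h2 : finrank F (SumRank.matrixDual A) = finrank F (traceOrthogonal B) := by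
      rw [SumRank.matrixDual, ← hB]
      change finrank F (Submodule.comap ((Matrix.toLin' : Matrix (Fin m) (Fin n) F ≃ₗ[F] _) :
        Matrix (Fin m) (Fin n) F →ₗ[F] _) (traceOrthogonal B)) = _
      rw [Submodule.comap_equiv_eq_map_symm, LinearEquiv.finrank_map_eq]
    rw [h2, Nat.mul_sub, mul_comm m n]
    omega

theorem IsAnticodeOfRank.exists_le (hnm : n ≤ m) [NeZero m]
    {A : Submodule F (Matrix (Fin m) (Fin n) F)} {k : ℕ} (hA : IsAnticodeOfRank A (k + 1)) :
    ∃ B ≤ A, IsAnticodeOfRank B k := by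
  obtain ⟨B, hBA, hB, hBdim⟩ := exists_le_rank_le_pred (V := Fin n → F) (W := Fin m → F)
    (by simpa using hnm) (rank_le_of_mem_linSpace hA.1)
    (by rw [finrank_linSpace, hA.2, Module.finrank_fin_fun]) (by simpa using hA.le)
  rw [Module.finrank_fin_fun] at hBdim
  refine ⟨B.map (Matrix.toLin' : Matrix (Fin m) (Fin n) F ≃ₗ[F] _).symm.toLinearMap, ?_, ?_, ?_⟩
  · rintro _ ⟨N, hN, rfl⟩
    obtain ⟨M, hM, rfl⟩ := hBA hN
    simpa using hM
  · rintro _ ⟨N, hN, rfl⟩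
    have h : Matrix.toLin' ((Matrix.toLin' : Matrix (Fin m) (Fin n) F ≃ₗ[F] _).symm N) = N :=
      LinearEquiv.apply_symm_apply _ _
    exact (congrArg (fun f => finrank F (LinearMap.range f)) h).trans_le (hB N hN)
  · rw [LinearEquiv.finrank_map_eq, hBdim]

/-- If rank `k` were not attained, the dimension bound with `k - 1` would contradict dimension `m *
k`. -/
theorem IsAnticodeOfRank.exists_rank_eq (hnm : n ≤ m) [NeZero m]
    {A : Submodule F (Matrix (Fin m) (Fin n) F)} {k : ℕ} (hA : IsAnticodeOfRank A k) :
    ∃ M ∈ A, M.rank = k := by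
  by_contra hcon
  push Not at hcon
  rcases k with _ | k
  · exact hcon 0 A.zero_mem (by simp)
  · have h := finrank_le_of_matrix_rank_le hnm (A := A) (k := k) (fun M hM => by
      have h1 := hA.1 M hM
      have h2 := hcon M hM
      omega)
    rw [hA.2] at h
    have := Nat.le_of_mul_le_mul_left h (NeZero.pos m)
    omega

theorem isOptimalAnticode_iff (hnm : n ≤ m) [NeZero m]
    {A : Submodule F (Matrix (Fin m) (Fin n) F)} :
    IsOptimalAnticode A ↔ ∃ k, IsAnticodeOfRank A k := by
  constructor
  · intro h
    have hne : {w | ∃ M ∈ A, w = m * M.rank}.Nonempty := ⟨_, 0, A.zero_mem, rfl⟩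
    have hbdd : BddAbove {w | ∃ M ∈ A, w = m * M.rank} := by
      refine ⟨m * n, ?_⟩
      rintro _ ⟨M, -, rfl⟩
      exact Nat.mul_le_mul_left _ (by simpa using M.rank_le_width)
    obtain ⟨M, hM, hMw⟩ := Nat.sSup_mem hne hbdd
    refine ⟨M.rank, fun N hN => ?_, ?_⟩
    · have h1 : m * N.rank ≤ m * M.rank := by
        rw [← hMw]
        exact le_csSup hbdd ⟨N, hN, rfl⟩
      exact Nat.le_of_mul_le_mul_left h1 (NeZero.pos m)
    · rw [← hMw]
      exact h
  · rintro ⟨k, hk⟩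
    obtain ⟨M, hM, hMk⟩ := hk.exists_rank_eq hnm
    rw [IsOptimalAnticode, hk.2]
    symm
    apply IsGreatest.csSup_eq
    refine ⟨⟨M, hM, by rw [hMk]⟩, ?_⟩
    rintro _ ⟨N, hN, rfl⟩
    exact Nat.mul_le_mul_left _ (hk.1 N hN)

end MatrixAnticodes

end SumRank

namespace SumRank

open Module

/-! ### The trace form on the ambient space. -/

section Duality

variable {F : Type*} [Field F] {ℓ m : ℕ} {n : Fin ℓ → ℕ}

theorem traceForm_eq_sum (D C : Space F (fun _ : Fin ℓ => m) n) :
    traceForm D C = ∑ i, ∑ a, ∑ b, D i a b * C i a b := by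
  simp [traceForm, Matrix.trace, Matrix.mul_apply]

theorem traceForm_comm (D C : Space F (fun _ : Fin ℓ => m) n) :
    traceForm D C = traceForm C D := by
  simp only [traceForm_eq_sum, mul_comm]

/-- The trace form as a bilinear form. -/
noncomputable def traceBilin (F : Type*) [Field F] {ℓ : ℕ} (m : ℕ) (n : Fin ℓ → ℕ) :
    LinearMap.BilinForm F (Space F (fun _ : Fin ℓ => m) n) :=
  LinearMap.mk₂ F traceForm
    (fun D D' C => by simp [traceForm, Matrix.add_mul, Finset.sum_add_distrib])
    (fun c D C => by simp [traceForm, ← Finset.mul_sum])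
    (fun D C C' => by simp [traceForm, Matrix.mul_add, Finset.sum_add_distrib])
    (fun c D C => by simp [traceForm, ← Finset.mul_sum])

theorem traceBilin_apply (D C : Space F (fun _ : Fin ℓ => m) n) :
    traceBilin F m n D C = traceForm D C := rfl

theorem traceBilin_nondegenerate : (traceBilin F m n).Nondegenerate := by
  have key : ∀ D : Space F (fun _ : Fin ℓ => m) n, (∀ C, traceForm D C = 0) → D = 0 := by
    intro D hD
    funext i
    ext a b
    have h := hD (Pi.single i (Matrix.single a b 1))
    rw [traceForm, Finset.sum_eq_single i] at h
    · simpa [Matrix.trace_mul_single] using h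
    · intro j _ hj
      simp [Pi.single_eq_of_ne hj]
    · simp
  refine ⟨fun D hD => key D hD, fun D hD => key D fun C => ?_⟩
  rw [traceForm_comm]
  exact hD C

theorem dual_eq_orthogonal (𝒞 : Submodule F (Space F (fun _ : Fin ℓ => m) n)) :
    dual 𝒞 = (traceBilin F m n).orthogonal 𝒞 := by
  ext D
  rw [LinearMap.BilinForm.mem_orthogonal_iff]
  refine forall₂_congr fun C _ => ?_
  rw [traceForm_comm]
  rfl

theorem finrank_space : finrank F (Space F (fun _ : Fin ℓ => m) n) = m * ∑ i, n i := by
  rw [Module.finrank_pi_fintype, Finset.mul_sum]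
  refine Finset.sum_congr rfl fun i _ => ?_
  rw [Module.finrank_matrix, Module.finrank_self, mul_one, Fintype.card_fin, Fintype.card_fin]

theorem finrank_add_finrank_dual (𝒞 : Submodule F (Space F (fun _ : Fin ℓ => m) n)) :
    finrank F 𝒞 + finrank F (dual 𝒞) = m * ∑ i, n i := by
  have h := LinearMap.BilinForm.finrank_orthogonal traceBilin_nondegenerate 𝒞
  have h2 := Submodule.finrank_le 𝒞
  rw [← dual_eq_orthogonal] at h
  rw [finrank_space] at h h2
  omega

theorem dual_dual (𝒞 : Submodule F (Space F (fun _ : Fin ℓ => m) n)) : dual (dual 𝒞) = 𝒞 := by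
  have hle : 𝒞 ≤ dual (dual 𝒞) := fun C hC D hD => (traceForm_comm C D).trans (hD C hC)
  refine (Submodule.eq_of_le_of_finrank_eq hle ?_).symm
  have h1 := finrank_add_finrank_dual 𝒞
  have h2 := finrank_add_finrank_dual (dual 𝒞)
  omega

theorem dual_sup (𝒞 𝒟 : Submodule F (Space F (fun _ : Fin ℓ => m) n)) :
    dual (𝒞 ⊔ 𝒟) = dual 𝒞 ⊓ dual 𝒟 := by
  apply le_antisymm
  · exact fun D hD => ⟨fun C hC => hD C (Submodule.mem_sup_left hC),
      fun C hC => hD C (Submodule.mem_sup_right hC)⟩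
  · rintro D ⟨h1, h2⟩ C hC
    obtain ⟨C₁, hC₁, C₂, hC₂, rfl⟩ := Submodule.mem_sup.mp hC
    rw [← traceBilin_apply, map_add, traceBilin_apply, traceBilin_apply, h1 C₁ hC₁, h2 C₂ hC₂,
      add_zero]

theorem dual_pi (A : (i : Fin ℓ) → Submodule F (Matrix (Fin m) (Fin (n i)) F)) :
    dual (Submodule.pi Set.univ A : Submodule F (Space F (fun _ : Fin ℓ => m) n)) =
      Submodule.pi Set.univ fun i => matrixDual (A i) := by
  ext D
  constructor
  · intro hD i _
    change D i ∈ matrixDual (A i)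
    rw [mem_matrixDual]
    intro C hC
    have h := hD (Pi.single i C) (fun j _ => by
      by_cases hj : j = i
      · subst hj
        simpa using hC
      · simp [Pi.single_eq_of_ne hj])
    rw [traceForm, Finset.sum_eq_single i] at h
    · simpa using h
    · intro j _ hj
      simp [Pi.single_eq_of_ne hj]
    · simp
  · intro hD C hC
    exact Finset.sum_eq_zero fun i _ => mem_matrixDual.mp (hD i trivial) (C i) (hC i trivial)

theorem finrank_pi_submodule (A : (i : Fin ℓ) → Submodule F (Matrix (Fin m) (Fin (n i)) F)) :
    finrank F (Submodule.pi Set.univ A : Submodule F (Space F (fun _ : Fin ℓ => m) n)) =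
      ∑ i, finrank F (A i) := by
  rw [← Module.finrank_pi_fintype F]
  refine LinearEquiv.finrank_eq
    { toFun := fun C i => ⟨C.1 i, C.2 i trivial⟩
      invFun := fun C => ⟨fun i => (C i).1, fun i _ => (C i).2⟩
      map_add' := fun _ _ => rfl
      map_smul' := fun _ _ => rfl
      left_inv := fun _ => rfl
      right_inv := fun _ => rfl }

end Duality

/-! ### Intersection dimensions with products of anticodes, and generalized weights. -/

section Meets

variable {F : Type*} [Field F] {ℓ m : ℕ} {n : Fin ℓ → ℕ}

/-- Some product of optimal anticodes of maximum sum-rank `j` meets `𝒞` in dimension at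
least `t`. -/
def Meets (𝒞 : Submodule F (Space F (fun _ : Fin ℓ => m) n)) (j : ℕ) (t : ℤ) : Prop :=
  ∃ (A : (i : Fin ℓ) → Submodule F (Matrix (Fin m) (Fin (n i)) F)) (κ : Fin ℓ → ℕ),
    (∀ i, IsAnticodeOfRank (A i) (κ i)) ∧ ∑ i, κ i = j ∧
      t ≤ finrank F ↥(𝒞 ⊓ Submodule.pi Set.univ A)

theorem finrank_pi_of_isAnticodeOfRank
    {A : (i : Fin ℓ) → Submodule F (Matrix (Fin m) (Fin (n i)) F)} {κ : Fin ℓ → ℕ}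
    (hA : ∀ i, IsAnticodeOfRank (A i) (κ i)) :
    finrank F (Submodule.pi Set.univ A : Submodule F (Space F (fun _ : Fin ℓ => m) n)) =
      m * ∑ i, κ i := by
  rw [finrank_pi_submodule, Finset.mul_sum]
  exact Finset.sum_congr rfl fun i _ => (hA i).2

variable {𝒞 : Submodule F (Space F (fun _ : Fin ℓ => m) n)} {j : ℕ} {t : ℤ}

theorem Meets.mono {t' : ℤ} (h : Meets 𝒞 j t) (ht : t' ≤ t) : Meets 𝒞 j t' := by
  obtain ⟨A, κ, hA, hj, h⟩ := h
  exact ⟨A, κ, hA, hj, ht.trans h⟩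

theorem Meets.le_finrank (h : Meets 𝒞 j t) : t ≤ finrank F 𝒞 := by
  obtain ⟨A, κ, -, -, h⟩ := h
  exact h.trans (by exact_mod_cast Submodule.finrank_mono inf_le_left)

theorem Meets.nonpos (h : Meets 𝒞 0 t) : t ≤ 0 := by
  obtain ⟨A, κ, hA, hj, h⟩ := h
  have h1 := finrank_pi_of_isAnticodeOfRank hA
  have h2 : finrank F ↥(𝒞 ⊓ Submodule.pi Set.univ A) ≤
    finrank F (Submodule.pi Set.univ A : Submodule F (Space F (fun _ : Fin ℓ => m) n)) :=
    Submodule.finrank_mono inf_le_right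
  rw [hj, mul_zero] at h1
  omega

theorem meets_sum (ht : t ≤ finrank F 𝒞) : Meets 𝒞 (∑ i, n i) t := by
  refine ⟨fun _ => ⊤, n, fun i => isAnticodeOfRank_top, rfl, ?_⟩
  rwa [Submodule.pi_top, inf_top_eq]

theorem meets_zero : Meets 𝒞 0 0 := by
  refine ⟨fun _ => ⊥, fun _ => 0, fun i => ⟨?_, by simp⟩, by simp, by positivity⟩
  rintro M hM
  rw [(Submodule.mem_bot F).mp hM]
  simp

variable [NeZero m]

theorem Meets.le_sum (h : Meets 𝒞 j t) : j ≤ ∑ i, n i := by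
  obtain ⟨A, κ, hA, rfl, -⟩ := h
  exact Finset.sum_le_sum fun i _ => (hA i).le

variable [Finite F]

/-- Use the orthogonal product `A^⊥`: `𝒞^⊥ ∩ A^⊥ = (𝒞 + A)^⊥`, whose dimension is determined by
`dim(𝒞 ∩ A)`. -/
theorem Meets.dual (hnm : ∀ i, n i ≤ m) {j' : ℕ} (hj' : j + j' = ∑ i, n i) (h : Meets 𝒞 j t) :
    Meets (dual 𝒞) j' (t + m * j' - finrank F 𝒞) := by
  obtain ⟨A, κ, hA, hj, h⟩ := h
  refine ⟨fun i => matrixDual (A i), fun i => n i - κ i,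
    fun i => (hA i).matrixDual (hnm i), ?_, ?_⟩
  · have : ∑ i, (n i - κ i) + ∑ i, κ i = ∑ i, n i := by
      rw [← Finset.sum_add_distrib]
      exact Finset.sum_congr rfl fun i _ => Nat.sub_add_cancel (hA i).le
    change ∑ i, (n i - κ i) = j'
    omega
  · rw [← dual_pi, ← dual_sup]
    have h1 := finrank_add_finrank_dual (𝒞 ⊔ Submodule.pi Set.univ A)
    have h2 := Submodule.finrank_sup_add_finrank_inf_eq 𝒞 (Submodule.pi Set.univ A)
    rw [finrank_pi_of_isAnticodeOfRank hA, hj] at h2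
    rw [← hj', mul_add] at h1
    zify at h1 h2
    linarith

theorem meets_dual_iff (hnm : ∀ i, n i ≤ m) {j' : ℕ} (hj' : j' + j = ∑ i, n i) {u : ℤ} :
    Meets (SumRank.dual 𝒞) j u ↔ Meets 𝒞 j' (u - m * j + finrank F 𝒞) := by
  have hd := finrank_add_finrank_dual 𝒞
  rw [← hj'] at hd
  zify at hd
  constructor
  · intro h
    have h1 := h.dual hnm (by omega : j + j' = ∑ i, n i)
    rw [dual_dual] at h1
    exact h1.mono (by linarith)
  · intro h
    exact (h.dual hnm hj').mono (by linarith)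

/-- Shrink one factor of positive rank to an optimal anticode of rank one less. The product loses
`m` dimensions, so its intersection with `𝒞` loses at most `m`. -/
theorem Meets.pred (hnm : ∀ i, n i ≤ m) (h : Meets 𝒞 (j + 1) t) : Meets 𝒞 j (t - m) := by
  obtain ⟨A, κ, hA, hj, h⟩ := h
  obtain ⟨i, hi⟩ : ∃ i, κ i ≠ 0 := by
    by_contra hcon
    push Not at hcon
    simp [hcon] at hj
  obtain ⟨k, hk⟩ := Nat.exists_eq_succ_of_ne_zero hi
  obtain ⟨B, hBA, hB⟩ := IsAnticodeOfRank.exists_le (hnm i) (hk ▸ hA i)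
  have hA' : ∀ l, IsAnticodeOfRank (Function.update A i B l) (Function.update κ i k l) := by
    intro l
    by_cases hl : l = i
    · subst hl
      simpa using hB
    · simpa [hl] using hA l
  have hκ : ∑ l, Function.update κ i k l = j := by
    have h1 := Finset.add_sum_erase Finset.univ κ (Finset.mem_univ i)
    have h2 := Finset.add_sum_erase Finset.univ (Function.update κ i k) (Finset.mem_univ i)
    have h3 : ∑ l ∈ Finset.univ.erase i, Function.update κ i k l =
        ∑ l ∈ Finset.univ.erase i, κ l :=
      Finset.sum_congr rfl fun l hl => by
        rw [Function.update_of_ne (Finset.ne_of_mem_erase hl)]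
    rw [Function.update_self] at h2
    omega
  refine ⟨_, _, hA', hκ, ?_⟩
  set P : Submodule F (Space F (fun _ : Fin ℓ => m) n) := Submodule.pi Set.univ A with hP
  set Q : Submodule F (Space F (fun _ : Fin ℓ => m) n) :=
    Submodule.pi Set.univ (Function.update A i B) with hQ
  have hQP : Q ≤ P := by
    intro C hC l _
    have : C l ∈ Function.update A i B l := hC l trivial
    change C l ∈ A l
    by_cases hl : l = i
    · subst hl
      rw [Function.update_self] at this
      exact hBA this
    · rwa [Function.update_of_ne hl] at this
  have h1 := Submodule.finrank_sup_add_finrank_inf_eq (𝒞 ⊓ P) Q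
  have h2 : finrank F ↥(𝒞 ⊓ P ⊔ Q) ≤ finrank F P :=
    Submodule.finrank_mono (sup_le inf_le_right hQP)
  rw [inf_assoc, inf_eq_right.mpr hQP] at h1
  rw [hP, finrank_pi_of_isAnticodeOfRank hA, hj, mul_add, mul_one, ← hP] at h2
  have h3 : finrank F Q = m * j := by rw [hQ, finrank_pi_of_isAnticodeOfRank hA', hκ]
  omega

/-- Enlarging an anticode is shrinking its orthogonal: the loss of `m` in `Meets.pred` is exactly
compensated by the shift in the duality. -/
theorem Meets.succ (hnm : ∀ i, n i ≤ m) (hj : j < ∑ i, n i) (h : Meets 𝒞 j t) :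
    Meets 𝒞 (j + 1) t := by
  obtain ⟨d, hd⟩ := Nat.exists_eq_add_of_lt hj
  have h1 := (h.dual hnm (by omega : j + (d + 1) = ∑ i, n i)).pred hnm
  rw [meets_dual_iff hnm (by omega : (j + 1) + d = ∑ i, n i)] at h1
  refine h1.mono ?_
  push_cast
  linarith

theorem Meets.of_le (hnm : ∀ i, n i ≤ m) {j' : ℕ} (hjj' : j ≤ j') (hj' : j' ≤ ∑ i, n i)
    (h : Meets 𝒞 j t) : Meets 𝒞 j' t := by
  induction j', hjj' using Nat.le_induction with
  | base => exact h
  | succ d _ ih => exact (ih (by omega)).succ hnm (by omega)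

theorem meets_of_nonpos (hnm : ∀ i, n i ≤ m) (hj : j ≤ ∑ i, n i) (ht : t ≤ 0) : Meets 𝒞 j t :=
  (meets_zero.of_le hnm (Nat.zero_le j) hj).mono ht

theorem maxsrk_pi (hnm : ∀ i, n i ≤ m)
    {A : (i : Fin ℓ) → Submodule F (Matrix (Fin m) (Fin (n i)) F)} {κ : Fin ℓ → ℕ}
    (hA : ∀ i, IsAnticodeOfRank (A i) (κ i)) :
    maxsrk (Submodule.pi Set.univ A : Submodule F (Space F (fun _ : Fin ℓ => m) n)) =
      ∑ i, κ i := by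
  choose M hM hMκ using fun i => (hA i).exists_rank_eq (hnm i)
  apply IsGreatest.csSup_eq
  refine ⟨⟨M, fun i _ => hM i, by simp [srk, hMκ]⟩, ?_⟩
  rintro _ ⟨C, hC, rfl⟩
  exact Finset.sum_le_sum fun i _ => (hA i).1 _ (hC i trivial)

theorem genWeight_eq_sInf_meets (hnm : ∀ i, n i ≤ m)
    (𝒞 : Submodule F (Space F (fun _ : Fin ℓ => m) n)) (r : ℕ) :
    genWeight 𝒞 r = sInf {j | Meets 𝒞 j r} := by
  rw [genWeight]
  congr 1
  ext w
  constructor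
  · rintro ⟨A, hA, hr, rfl⟩
    choose κ hκ using fun i => (isOptimalAnticode_iff (hnm i)).mp (hA i)
    exact ⟨A, κ, hκ, (maxsrk_pi hnm hκ).symm, by exact_mod_cast hr⟩
  · rintro ⟨A, κ, hκ, hw, hr⟩
    exact ⟨A, fun i => (isOptimalAnticode_iff (hnm i)).mpr ⟨_, hκ i⟩, by exact_mod_cast hr,
      by rw [maxsrk_pi hnm hκ, hw]⟩

theorem meets_genWeight (hnm : ∀ i, n i ≤ m) {r : ℕ} (hr : r ≤ finrank F 𝒞) :
    Meets 𝒞 (genWeight 𝒞 r) r := by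
  rw [genWeight_eq_sInf_meets hnm]
  exact Nat.sInf_mem (s := {j | Meets 𝒞 j r}) ⟨_, meets_sum (by exact_mod_cast hr)⟩

theorem genWeight_le_iff (hnm : ∀ i, n i ≤ m) {r : ℕ} (hr : r ≤ finrank F 𝒞)
    (hj : j ≤ ∑ i, n i) : genWeight 𝒞 r ≤ j ↔ Meets 𝒞 j r := by
  refine ⟨fun h => (meets_genWeight hnm hr).of_le hnm h hj, fun h => ?_⟩
  rw [genWeight_eq_sInf_meets hnm]
  exact Nat.sInf_le h

/-- Expresses a weight as a jump of `Meets` between `w` and `w + 1`. The range condition on `r + sm`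
becomes automatic: nonpositive values are met at every `j ≤ n`, values above `dim 𝒞` at none. -/
theorem mem_weightSet_iff (hnm : ∀ i, n i ≤ m) {v r : ℤ} :
    v ∈ weightSet 𝒞 r ↔ ∃ w : ℕ, v = (w + 1 : ℕ) ∧ w + 1 ≤ ∑ i, n i ∧
      ∃ s : ℤ, Meets 𝒞 (w + 1) (r + s * m) ∧ ¬ Meets 𝒞 w (r + s * m) := by
  constructor
  · rintro ⟨s, t, ht, ht1, htd, rfl⟩
    have h1 := meets_genWeight hnm htd
    obtain ⟨w, hw⟩ : ∃ w, genWeight 𝒞 t = w + 1 := by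
      apply Nat.exists_eq_succ_of_ne_zero
      intro h0
      rw [h0] at h1
      have := h1.nonpos
      omega
    rw [hw] at h1
    refine ⟨w, by rw [hw], h1.le_sum, s, ht ▸ h1, fun h2 => ?_⟩
    rw [← ht] at h2
    have := (genWeight_le_iff hnm htd h2.le_sum).mpr h2
    omega
  · rintro ⟨w, rfl, hw, s, h1, h2⟩
    have hpos : 0 < r + s * m := by
      by_contra hcon
      exact h2 (meets_of_nonpos hnm (by omega) (by omega))
    obtain ⟨t, ht⟩ := Int.eq_ofNat_of_zero_le hpos.le
    rw [ht] at h1 h2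
    have htd : t ≤ finrank F 𝒞 := by exact_mod_cast h1.le_finrank
    refine ⟨s, t, ht.symm, by omega, htd, ?_⟩
    rw [← genWeight_le_iff hnm htd hw] at h1
    rw [← genWeight_le_iff hnm htd (by omega)] at h2
    exact_mod_cast (by omega : w + 1 = genWeight 𝒞 t)

end Meets

/-- Let `s₀` be the largest `s` with `Q₀ (ρ + s m)`. As both predicates are downward closed, the
left side says that `Q₁` fails at `s₀ + 1`, and the existence statement negated on the right says
that `Q₁` holds there. -/
theorem exists_iff_not_exists_of_antitone {Q₀ Q₁ : ℤ → Prop} {m : ℕ} (hm : 0 < m)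
    (h₀ : ∀ t t', t' ≤ t → Q₀ t → Q₀ t') (h₁ : ∀ t t', t' ≤ t → Q₁ t → Q₁ t')
    (hz : Q₀ 0) {b : ℕ} (hb : ∀ t, Q₀ t → t ≤ b) (ρ : ℤ) :
    (∃ s : ℤ, Q₀ (ρ + s * m - m) ∧ ¬ Q₁ (ρ + s * m)) ↔
      ¬ ∃ s : ℤ, Q₁ (ρ + s * m) ∧ ¬ Q₀ (ρ + s * m) := by
  have hm' : (1 : ℤ) ≤ m := by exact_mod_cast hm
  constructor
  · rintro ⟨s', h1, h2⟩ ⟨s, h3, h4⟩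
    have h5 : s < s' := by
      by_contra hcon
      refine h2 (h₁ _ _ ?_ h3)
      nlinarith
    have h6 : s' - 1 < s := by
      by_contra hcon
      refine h4 (h₀ _ _ ?_ h1)
      nlinarith
    omega
  · intro hno
    obtain ⟨s, hs, hmax⟩ := Int.exists_greatest_of_bdd (P := fun s : ℤ => Q₀ (ρ + s * m))
      ⟨(b : ℤ) + |ρ|, fun s hs => by
        by_contra hcon
        have h1 := hb _ hs
        have h2 := neg_abs_le ρ
        have h3 := abs_nonneg ρ
        nlinarith⟩
      -- At `s = -|ρ|` the argument is nonpositive since `m ≥ 1`, so `Q₀ 0` applies.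
      ⟨-|ρ|, h₀ 0 _ (by
        have h2 := le_abs_self ρ
        have h3 := abs_nonneg ρ
        nlinarith) hz⟩
    have hnot : ¬ Q₀ (ρ + (s + 1) * m) := fun h => by
      have := hmax _ h
      omega
    refine ⟨s + 1, by convert hs using 1; ring, fun h => hno ⟨s + 1, h, hnot⟩⟩

end SumRank

/-! ### Complementarity of the weight sets, and determination of the dual weights. -/

theorem mainTheorem8 {F : Type*} [Field F] [Finite F] {ℓ m : ℕ} (hℓ : 0 < ℓ) (hm : 0 < m)
    (n : Fin ℓ → ℕ) (hn : ∀ i, 0 < n i) (hnm : ∀ i, n i ≤ m)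
    (𝒞 : Submodule F (SumRank.Space F (fun _ : Fin ℓ => m) n)) :
    (∀ r : ℕ, 1 ≤ r → r ≤ m →
      SumRank.weightSet (SumRank.dual 𝒞) (r : ℤ) =
        Set.Icc (1 : ℤ) ((∑ i, n i : ℕ) : ℤ) \
          SumRank.coweightSet 𝒞 ((r : ℤ) + (Module.finrank F 𝒞 : ℤ))) ∧
    (∀ 𝒟 : Submodule F (SumRank.Space F (fun _ : Fin ℓ => m) n),
      Module.finrank F 𝒟 = Module.finrank F 𝒞 →
      (∀ r : ℕ, 1 ≤ r → r ≤ Module.finrank F 𝒞 →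
        SumRank.genWeight 𝒟 r = SumRank.genWeight 𝒞 r) →
      Module.finrank F (SumRank.dual 𝒟) = Module.finrank F (SumRank.dual 𝒞) ∧
      ∀ r : ℕ, 1 ≤ r → r ≤ Module.finrank F (SumRank.dual 𝒞) →
        SumRank.genWeight (SumRank.dual 𝒟) r = SumRank.genWeight (SumRank.dual 𝒞) r) := by
  have : NeZero m := ⟨hm.ne'⟩
  refine ⟨fun r _ _ => ?_, fun 𝒟 hdim hgen => ⟨?_, fun r _ _ => ?_⟩⟩
  · have hco : ∀ v ρ : ℤ, v ∈ SumRank.coweightSet 𝒞 ρ ↔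
        ((∑ i, n i : ℕ) : ℤ) + 1 - v ∈ SumRank.weightSet 𝒞 ρ := by
      intro v ρ
      constructor
      · rintro ⟨s, t, h1, h2, h3, rfl⟩
        exact ⟨s, t, h1, h2, h3, by ring⟩
      · rintro ⟨s, t, h1, h2, h3, h4⟩
        exact ⟨s, t, h1, h2, h3, by rw [← h4]; ring⟩
    have key : ∀ w a : ℕ, a + (w + 1) = ∑ i, n i →
        ((∃ s : ℤ, SumRank.Meets (SumRank.dual 𝒞) (w + 1) (r + s * m) ∧
          ¬ SumRank.Meets (SumRank.dual 𝒞) w (r + s * m)) ↔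
        ¬ ∃ s : ℤ, SumRank.Meets 𝒞 (a + 1) (r + Module.finrank F 𝒞 + s * m) ∧
          ¬ SumRank.Meets 𝒞 a (r + Module.finrank F 𝒞 + s * m)) := by
      intro w a haw
      rw [← SumRank.exists_iff_not_exists_of_antitone hm (fun t t' h h' => h'.mono h)
        (fun t t' h h' => h'.mono h) (SumRank.meets_of_nonpos hnm (by omega) le_rfl)
        (fun t h => h.le_finrank)]
      constructor
      · rintro ⟨s, h1, h2⟩
        rw [SumRank.meets_dual_iff hnm haw] at h1
        rw [SumRank.meets_dual_iff hnm (by omega : (a + 1) + w = ∑ i, n i)] at h2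
        -- The dual shifts at `w + 1` and `w` are `-m(w + 1)` and `-mw`; reindexing by `w` leaves
        -- the offset `-m` on the first condition only.
        refine ⟨s - w, ?_, ?_⟩
        · convert h1 using 1
          push_cast
          ring
        · convert h2 using 2
          ring
      · rintro ⟨s, h1, h2⟩
        refine ⟨s + w, ?_, ?_⟩
        · rw [SumRank.meets_dual_iff hnm haw]
          convert h1 using 1
          push_cast
          ring
        · rw [SumRank.meets_dual_iff hnm (by omega : (a + 1) + w = ∑ i, n i)]
          convert h2 using 2
          ring
    ext v
    rw [Set.mem_sdiff, Set.mem_Icc, hco, SumRank.mem_weightSet_iff hnm,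
      SumRank.mem_weightSet_iff hnm]
    constructor
    · rintro ⟨w, rfl, hw, h⟩
      refine ⟨⟨by push_cast; omega, by exact_mod_cast hw⟩, ?_⟩
      rintro ⟨a, ha, -, h'⟩
      exact (key w a (by omega)).mp h h'
    · rintro ⟨⟨h1, h2⟩, hno⟩
      obtain ⟨w, rfl⟩ : ∃ w : ℕ, v = (w + 1 : ℕ) := ⟨(v - 1).toNat, by push_cast; omega⟩
      have hw : w + 1 ≤ ∑ i, n i := by exact_mod_cast h2
      obtain ⟨a, ha⟩ := Nat.exists_eq_add_of_le' hw
      refine ⟨w, rfl, hw, (key w a ha.symm).mpr fun h' => hno ⟨a, ?_, by omega, h'⟩⟩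
      rw [ha]
      push_cast
      ring
  · have h1 := SumRank.finrank_add_finrank_dual 𝒞
    have h2 := SumRank.finrank_add_finrank_dual 𝒟
    omega
  -- For `j ≤ n` the weights and the dimension determine `Meets`: it always holds for `t ≤ 0`, never
  -- for `t > dim 𝒞`, and in between it says that the `t`-th weight is at most `j`. Duality then
  -- carries the equality over to the dual codes.
  · have hmeets : ∀ (j : ℕ) (t : ℤ), j ≤ ∑ i, n i →
        (SumRank.Meets 𝒟 j t ↔ SumRank.Meets 𝒞 j t) := by
      intro j t hj
      rcases le_or_gt t 0 with ht | ht
      · exact iff_of_true (SumRank.meets_of_nonpos hnm hj ht) (SumRank.meets_of_nonpos hnm hj ht)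
      obtain ⟨t, rfl⟩ := Int.eq_ofNat_of_zero_le ht.le
      rcases le_or_gt t (Module.finrank F 𝒞) with htd | htd
      · rw [← SumRank.genWeight_le_iff hnm (htd.trans hdim.ge) hj,
          ← SumRank.genWeight_le_iff hnm htd hj, hgen t (by omega) htd]
      · refine iff_of_false (fun h => ?_) (fun h => ?_)
        · have := h.le_finrank
          omega
        · have := h.le_finrank
          omega
    rw [SumRank.genWeight_eq_sInf_meets hnm, SumRank.genWeight_eq_sInf_meets hnm]
    congr 1
    ext j
    by_cases hj : j ≤ ∑ i, n i
    · obtain ⟨a, ha⟩ := Nat.exists_eq_add_of_le' hj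
      change SumRank.Meets _ _ _ ↔ SumRank.Meets _ _ _
      rw [SumRank.meets_dual_iff hnm ha.symm, SumRank.meets_dual_iff hnm ha.symm, hdim]
      exact hmeets a _ (by omega)
    · exact iff_of_false (fun h => hj h.le_sum) (fun h => hj h.le_sum)
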